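/- For $n\in\mathbb N$ let $L(n,p_1,p_2)$ be the following random double graph. Its vertex set is $V=[n]^{(2)}$, the set of two-element subsets of $[n]=\{1,\dots,n\}$; every two distinct intersecting pairs $e,f\in V$ are joined by a red edge with probability $p_1$ and by a blue edge with probability $p_2$, all these choices (over all such $\{e,f\}$ and both colours) being independent; disjoint pairs are never joined. Jigsaw percolation on a double graph is the following deterministic process. At time $0$ every vertex forms its own cluster. At time $t$ let $\widetilde G_t$ be the graph on the current clusters in which two distinct clusters are adjacent if they are joined by at least one red edge and at least one blue edge; the clusters at time $t+1$ are the unions of the clusters belonging to the same component of $\widetilde G_t$. The process percolates if at some time all vertices lie in a single cluster. **Theorem.** There is an absolute constant $c>0$ such that the following holds for all sequences $p_1=p_1(n)$ and $p_2=p_2(n)$ in $[0,1]$. (i) If $p_1p_2\le \dfrac{1}{c\,n\log n}$ for all sufficiently large $n$, then the probability that $L(n,p_1,p_2)$ does not percolate tends to $1$ as $n\to\infty$. (ii) If $p_1p_2\ge \dfrac{c}{n\log n}$ and $\min\{p_1,p_2\}\ge \dfrac{c\log n}{n}$ for all sufficiently large $n$, then the probability that $L(n,p_1,p_2)$ percolates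 tends to $1$ as $n\to\infty$. (It is in this sense that the threshold for jigsaw percolation on $L(n,p_1,p_2)$, in terms of the product $p_1p_2$, is of order $\Theta\!\left(\frac{1}{n\log n}\right)$.) -/

import Mathlib

open Filter Topology MeasureTheory ProbabilityTheory

/-! ### Jigsaw percolation on a double graph -/

/-- The auxiliary graph on the clusters (the classes of `s`) of a double graph with red graph `R`
and blue graph `B`: two distinct clusters are adjacent when at least one red edge and at least one
blue edge join them. -/
def jigsawClusterGraph {V : Type*} (R B : SimpleGraph V) (s : Setoid V) :
    SimpleGraph (Quotient s) where
  Adj C D := C ≠ D ∧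
    (∃ u v : V, Quotient.mk s u = C ∧ Quotient.mk s v = D ∧ R.Adj u v) ∧
    (∃ u v : V, Quotient.mk s u = C ∧ Quotient.mk s v = D ∧ B.Adj u v)
  symm := ⟨by
    rintro C D ⟨hne, ⟨u, v, hu, hv, h⟩, ⟨x, y, hx, hy, h'⟩⟩
    exact ⟨hne.symm, ⟨v, u, hv, hu, h.symm⟩, ⟨y, x, hy, hx, h'.symm⟩⟩⟩
  loopless := ⟨fun _ h => h.1 rfl⟩

/-- One step of the process: the new clusters are the unions of the old clusters that belong to
the same component of the auxiliary graph. -/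
def jigsawStep {V : Type*} (R B : SimpleGraph V) (s : Setoid V) : Setoid V :=
  Setoid.comap (Quotient.mk s) (jigsawClusterGraph R B s).reachableSetoid

/-- The partition into clusters at time `t`; at time `0` every vertex forms its own cluster. -/
def jigsawClusters {V : Type*} (R B : SimpleGraph V) : ℕ → Setoid V
  | 0 => ⊥
  | t + 1 => jigsawStep R B (jigsawClusters R B t)

/-- The double graph with red graph `R` and blue graph `B` percolates: at some time all vertices
lie in a single cluster. (Stopping at an auxiliary graph without edges is the same as letting the
process run on, since the partition then stays constant.) -/
def JigsawPercolates {V : Type*} (R B : SimpleGraph V) : Prop :=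
  ∃ t : ℕ, jigsawClusters R B t = ⊤

/-! ### The random double graph `L(n, p₁, p₂)` -/

/-- The two-element subsets of an `n`-element set. -/
abbrev TwoSets (n : ℕ) : Type := {s : Finset (Fin n) // s.card = 2}

/-- The graph of all admissible edges: two distinct pairs are adjacent when they intersect. -/
def intersectingPairs (n : ℕ) : SimpleGraph (TwoSets n) where
  Adj s t := s ≠ t ∧ (s.1 ∩ t.1).Nonempty
  symm := ⟨fun s t h => ⟨h.1.symm, by rw [Finset.inter_comm]; exact h.2⟩⟩
  loopless := ⟨fun _ h => h.1 rfl⟩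

/-- The law of the random subgraph of `F` in which every edge of `F` is present independently with
probability `p`. -/
noncomputable def randomSubgraph {V : Type*} (F : SimpleGraph V) (p : unitInterval) :
    Measure (SimpleGraph V) :=
  Measure.map SimpleGraph.fromEdgeSet (setBernoulli F.edgeSet p)

/-- The law of the pair (red graph, blue graph) of `L(n, p₁, p₂)`; the two colours are
independent. -/
noncomputable def lineDoubleGraph (n : ℕ) (p₁ p₂ : unitInterval) :
    Measure (SimpleGraph (TwoSets n) × SimpleGraph (TwoSets n)) :=
  (randomSubgraph (intersectingPairs n) p₁).prod (randomSubgraph (intersectingPairs n) p₂)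

/-!
The vertices of `L(n, p₁, p₂)` are the edges of the complete graph on `[n]`, and its admissible
edges form the line graph `F` of that complete graph. `F` has fewer than `n ^ 2` vertices and
maximum degree less than `2 * n`. The pairs containing a given `x : Fin n` form a clique, the
*star* of `x`; two stars share a single vertex of `F` and hence no edge, so the double graphs
inside the various stars are independent.

*Below the threshold.* If the process percolates then, since clusters can be merged one after
another, for every `k` there is a vertex set `S` with `k ≤ |S| < 2k` that is connected in red and
in blue (`JigsawPercolates.exists_doublyConnected`). Label `S` by `Fin M`. Red and blue
connectedness give two rooted trees on `Fin M`, encoded by parent maps. There are at most `M ^ M`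
choices for each tree, and a fixed red tree embeds in `F` in at most `n ^ 2 * (2 * n) ^ (M - 1)`
ways. Each `S` has `M!` labellings, so by `M ^ M / M! ≤ e ^ M` the expected number of such sets is
at most `e ^ M * M ^ M * n ^ 2 * (2 * n * p₁ * p₂) ^ (M - 1)` (`exists_doublyConnected_prob_le`).
For `M` of order `log n` this tends to `0` when `p₁ * p₂` is a small multiple of
`1 / (n * log n)`.

*Above the threshold.* A vertex is *attached* to a set if it sends a red and a blue edge to it; a
set obtained from a single vertex by adding attached vertices (`Grown`) ends up inside one
cluster. Let `m` be about `log n / 10`.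

* Inside a star, grow a set by adding one vertex at a time, looking for the next one in a fresh
  block of vertices (`prod_le_hasGrown`). A set of size `k` has `N * q` attached vertices on
  average in a block of size `N`, with `q` of order `k ^ 2 * p₁ * p₂`. Blocks of size of order
  `n / m` for `k ≤ m` and `n * m ^ (1/2) / k ^ (3/2)` beyond fit into the star, and growth up to
  size `m ^ 2` succeeds with probability at least `exp (-4 * m) ≥ n ^ (-1/2)`
  (`Supercritical.hasGrown_star_ge`).
* A union bound over all subsets shows that, with high probability, no proper subset of size at
  least `m ^ 2` of any star is *stuck*, that is, without attached vertices in the star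
  (`Supercritical.stuck_term_le`). So a star that contains a grown set of size `m ^ 2` lies in one
  cluster.
* By independence of the stars, more than `m ^ 2` of them contain such a set. Every other star
  meets more than `m ^ 2` of these, in vertices that belong to one cluster, and so it is absorbed
  as well (`percolates_of_stars`).
-/

namespace LineJigsaw

open scoped ENNReal

/-! ### Independence of events on disjoint edge sets -/

section
variable {V : Type*}

/-- The graphs `G` and `G'` have the same edges within the edge set `A`. -/
def AgreeOn (A : Set (Sym2 V)) (G G' : SimpleGraph V) : Prop :=
  ∀ e ∈ A, e ∈ G.edgeSet ↔ e ∈ G'.edgeSet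

theorem AgreeOn.mono {A B : Set (Sym2 V)} {G G' : SimpleGraph V} (h : AgreeOn B G G')
    (hAB : A ⊆ B) : AgreeOn A G G' := fun e he => h e (hAB he)

theorem AgreeOn.symm {A : Set (Sym2 V)} {G G' : SimpleGraph V} (h : AgreeOn A G G') :
    AgreeOn A G' G := fun e he => (h e he).symm

theorem randomSubgraph_eq_map [Finite V] (F : SimpleGraph V) (p : unitInterval) :
    randomSubgraph F p = Measure.map (fun x : Sym2 V → Prop => SimpleGraph.fromEdgeSet {e | x e})
      (Measure.infinitePi fun e : Sym2 V => unitInterval.toNNReal p • Measure.dirac (e ∈ F.edgeSet)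
        + unitInterval.toNNReal (unitInterval.symm p) • Measure.dirac False) := by
  rw [randomSubgraph, setBernoulli_eq_map, Measure.map_map (by fun_prop) (by fun_prop)]
  rfl

instance [Finite V] (F : SimpleGraph V) (p : unitInterval) :
    IsProbabilityMeasure (randomSubgraph F p) := by
  rw [randomSubgraph]
  exact Measure.isProbabilityMeasure_map (by fun_prop)

instance [Finite V] : Finite (SimpleGraph V) :=
  Finite.of_injective _ SimpleGraph.edgeSet_injective

instance [Finite V] : DiscreteMeasurableSpace (SimpleGraph V) := by
  have : MeasurableSingletonClass (SimpleGraph V) := by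
    refine ⟨fun G => ?_⟩
    have h := SimpleGraph.measurable_edgeSet (V := V) (measurableSet_singleton G.edgeSet)
    convert h using 1
    ext H
    simp
  infer_instance

/-- Functions of the edges in disjoint sets are independent under `randomSubgraph`. -/
theorem lintegral_mul_of_agreeOn [Finite V] (F : SimpleGraph V) (p : unitInterval)
    {A B : Set (Sym2 V)} (hAB : Disjoint A B) {f g : SimpleGraph V → ℝ≥0∞}
    (hf : ∀ G G', AgreeOn A G G' → f G = f G') (hg : ∀ G G', AgreeOn B G G' → g G = g G') :
    ∫⁻ G, f G * g G ∂randomSubgraph F p =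
      (∫⁻ G, f G ∂randomSubgraph F p) * ∫⁻ G, g G ∂randomSubgraph F p := by
  classical
  cases nonempty_fintype V
  have hΦ : Measurable fun x : Sym2 V → Prop => SimpleGraph.fromEdgeSet {e | x e} :=
    SimpleGraph.measurable_fromEdgeSet.comp (by fun_prop)
  rw [randomSubgraph_eq_map, lintegral_map .of_discrete hΦ, lintegral_map .of_discrete hΦ,
    lintegral_map .of_discrete hΦ]
  set P := Measure.infinitePi fun e : Sym2 V =>
    unitInterval.toNNReal p • Measure.dirac (e ∈ F.edgeSet)
        + unitInterval.toNNReal (unitInterval.symm p) • Measure.dirac False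
  have hind : iIndepFun (fun (e : Sym2 V) (x : Sym2 V → Prop) => x e) P :=
    iIndepFun_infinitePi (X := fun _ x => x) (fun _ => measurable_id)
  have hdisj : Disjoint A.toFinset B.toFinset := by
    rwa [Set.disjoint_toFinset]
  have h2 := hind.indepFun_finset A.toFinset B.toFinset hdisj (fun e => by fun_prop)
  -- a function of the edges in `A` factors through the restriction to `A`
  have key : ∀ (A : Set (Sym2 V)) (f : SimpleGraph V → ℝ≥0∞),
      (∀ G G', AgreeOn A G G' → f G = f G') →
      (fun x : Sym2 V → Prop => f (SimpleGraph.fromEdgeSet {e | x e})) =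
      (fun y : A.toFinset → Prop =>
        f (SimpleGraph.fromEdgeSet {e | ∃ h : e ∈ A.toFinset, y ⟨e, h⟩})) ∘
        (fun (x : Sym2 V → Prop) (i : A.toFinset) => x i) := by
    intro A f hf
    funext x
    refine hf _ _ fun e he => ?_
    simp [he]
  have h3 := h2.comp (φ := fun y : A.toFinset → Prop =>
        f (SimpleGraph.fromEdgeSet {e | ∃ h : e ∈ A.toFinset, y ⟨e, h⟩}))
      (ψ := fun y : B.toFinset → Prop =>
        g (SimpleGraph.fromEdgeSet {e | ∃ h : e ∈ B.toFinset, y ⟨e, h⟩}))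
      .of_discrete .of_discrete
  rw [← key A f hf, ← key B g hg] at h3
  refine lintegral_mul_eq_lintegral_mul_lintegral_of_indepFun ?_ ?_ h3
  · exact (Measurable.of_discrete (f := f)).comp hΦ
  · exact (Measurable.of_discrete (f := g)).comp hΦ

/-- The law of a random double graph inside `F`: independent red and blue random subgraphs. For
`F = intersectingPairs n` this is `lineDoubleGraph n`. -/
noncomputable def doubleGraph (F : SimpleGraph V) (p q : unitInterval) :
    Measure (SimpleGraph V × SimpleGraph V) :=
  (randomSubgraph F p).prod (randomSubgraph F q)

instance [Finite V] (F : SimpleGraph V) (p q : unitInterval) :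
    IsProbabilityMeasure (doubleGraph F p q) := by
  unfold doubleGraph; infer_instance

/-- The value `f H` depends only on the red and blue edges of `H` within `A`. -/
def DeterminedOn (A : Set (Sym2 V)) {β : Type*} (f : SimpleGraph V × SimpleGraph V → β) : Prop :=
  ∀ H H', AgreeOn A H.1 H'.1 → AgreeOn A H.2 H'.2 → f H = f H'

theorem DeterminedOn.comp {A : Set (Sym2 V)} {β γ : Type*}
    {f : SimpleGraph V × SimpleGraph V → β} (h : DeterminedOn A f) (φ : β → γ) :
    DeterminedOn A (fun H => φ (f H)) := fun H H' h1 h2 => by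
  simp only [h H H' h1 h2]

theorem DeterminedOn.forall_mem {ι : Type*} {s : Set ι} {A : ι → Set (Sym2 V)}
    {E : ι → SimpleGraph V × SimpleGraph V → Prop} (h : ∀ i ∈ s, DeterminedOn (A i) (E i)) :
    DeterminedOn (⋃ i ∈ s, A i) (fun H => ∀ i ∈ s, E i H) := fun H H' h1 h2 => by
  refine propext (forall₂_congr fun i hi => ?_)
  rw [h i hi H H' (h1.mono (Set.subset_biUnion_of_mem hi))
    (h2.mono (Set.subset_biUnion_of_mem hi))]

variable [Finite V] (F : SimpleGraph V) (p q : unitInterval)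

/-- Events determined by disjoint edge sets are independent: for one colour this is
`lintegral_mul_of_agreeOn`, applied to the blue graph with the red one fixed and then to the red
graph. -/
theorem doubleGraph_inter {A B : Set (Sym2 V)} (hAB : Disjoint A B)
    {E E' : SimpleGraph V × SimpleGraph V → Prop} (hE : DeterminedOn A E)
    (hE' : DeterminedOn B E') :
    (doubleGraph F p q).real {H | E H ∧ E' H} =
      (doubleGraph F p q).real {H | E H} * (doubleGraph F p q).real {H | E' H} := by
  simp only [measureReal_def, ← ENNReal.toReal_mul]
  congr 1
  have hcalc : ∀ D : SimpleGraph V × SimpleGraph V → Prop, doubleGraph F p q {H | D H} =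
      ∫⁻ G, randomSubgraph F q {G' | D (G, G')} ∂randomSubgraph F p := by
    intro D
    rw [doubleGraph, Measure.prod_apply .of_discrete]
    rfl
  rw [hcalc, hcalc, hcalc, ← lintegral_mul_of_agreeOn F p hAB]
  · refine lintegral_congr fun G => ?_
    have hind : ∀ D : SimpleGraph V → Prop, randomSubgraph F q {G' | D G'} =
        ∫⁻ G', Set.indicator {G' | D G'} 1 G' ∂randomSubgraph F q := by
      intro D
      rw [lintegral_indicator_one .of_discrete]
    rw [hind, hind, hind, ← lintegral_mul_of_agreeOn F q hAB]
    · refine lintegral_congr fun G' => ?_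
      rw [← Pi.mul_apply, ← Set.inter_indicator_one]
      rfl
    · intro G₁ G₂ h
      have : E (G, G₁) = E (G, G₂) := hE _ _ (fun _ _ => Iff.rfl) h
      simp only [Set.indicator, Set.mem_ofPred_eq, Pi.one_apply]
      split_ifs <;> simp_all
    · intro G₁ G₂ h
      have : E' (G, G₁) = E' (G, G₂) := hE' _ _ (fun _ _ => Iff.rfl) h
      simp only [Set.indicator, Set.mem_ofPred_eq, Pi.one_apply]
      split_ifs <;> simp_all
  · intro G₁ G₂ h
    have : ∀ G', E (G₁, G') = E (G₂, G') := fun G' => hE _ _ h (fun _ _ => Iff.rfl)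
    simp only [this]
  · intro G₁ G₂ h
    have : ∀ G', E' (G₁, G') = E' (G₂, G') := fun G' => hE' _ _ h (fun _ _ => Iff.rfl)
    simp only [this]

theorem doubleGraph_forall {ι : Type*} (s : Finset ι) {A : ι → Set (Sym2 V)}
    (hA : (s : Set ι).PairwiseDisjoint A)
    {E : ι → SimpleGraph V × SimpleGraph V → Prop} (hE : ∀ i ∈ s, DeterminedOn (A i) (E i)) :
    (doubleGraph F p q).real {H | ∀ i ∈ s, E i H} =
      ∏ i ∈ s, (doubleGraph F p q).real {H | E i H} := by
  classical
  induction s using Finset.induction_on with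
  | empty => simp
  | insert a s ha ih =>
    rw [Finset.prod_insert ha, ← ih (hA.subset (by simp)) (fun i hi => hE i (by simp [hi])),
      ← doubleGraph_inter F p q (A := A a) (B := ⋃ i ∈ (s : Set ι), A i)]
    · simp only [Finset.forall_mem_insert]
    · rw [Set.disjoint_iUnion₂_right]
      intro i hi
      exact hA (by simp) (by simp [Finset.mem_coe.1 hi]) (fun h => ha (h ▸ hi))
    · exact hE a (by simp)
    · exact DeterminedOn.forall_mem fun i hi => hE i (by simp [Finset.mem_coe.1 hi])

theorem randomSubgraph_edge {e : Sym2 V} (he : e ∈ F.edgeSet) :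
    (randomSubgraph F p).real {G | e ∈ G.edgeSet} = p := by
  have hΦ : Measurable fun x : Sym2 V → Prop => SimpleGraph.fromEdgeSet {e | x e} :=
    SimpleGraph.measurable_fromEdgeSet.comp (by fun_prop)
  have hd : ¬ e.IsDiag := F.not_isDiag_of_mem_edgeSet he
  rw [randomSubgraph_eq_map, map_measureReal_apply hΦ .of_discrete]
  set P := Measure.infinitePi fun e : Sym2 V =>
    unitInterval.toNNReal p • Measure.dirac (e ∈ F.edgeSet)
        + unitInterval.toNNReal (unitInterval.symm p) • Measure.dirac False with hP
  have h1 : (fun x : Sym2 V → Prop => SimpleGraph.fromEdgeSet {e | x e}) ⁻¹' {G | e ∈ G.edgeSet} =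
      (fun x : Sym2 V → Prop => x e) ⁻¹' {True} := by
    ext x; simp [hd]
  rw [h1, ← map_measureReal_apply (measurable_pi_apply e) .of_discrete, hP,
    Measure.infinitePi_map_eval, measureReal_def]
  have h2 : (e ∈ F.edgeSet) = True := eq_true he
  have h3 : ((False : Prop) ∈ ({True} : Set Prop)) = False := by simp
  rw [h2, Measure.add_apply, Measure.smul_apply, Measure.smul_apply,
    Measure.dirac_apply' _ .of_discrete, Measure.dirac_apply' _ .of_discrete]
  simp [Set.indicator, ENNReal.smul_def]

theorem doubleGraph_fst (E : SimpleGraph V → Prop) :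
    (doubleGraph F p q).real {H | E H.1} = (randomSubgraph F p).real {G | E G} := by
  have : {H : SimpleGraph V × SimpleGraph V | E H.1} = {G | E G} ×ˢ Set.univ := by ext; simp
  rw [doubleGraph, this, measureReal_prod_prod]; simp

theorem doubleGraph_and (E E' : SimpleGraph V → Prop) :
    (doubleGraph F p q).real {H | E H.1 ∧ E' H.2} =
      (randomSubgraph F p).real {G | E G} * (randomSubgraph F q).real {G | E' G} := by
  have : {H : SimpleGraph V × SimpleGraph V | E H.1 ∧ E' H.2} = {G | E G} ×ˢ {G | E' G} := by
    ext; simp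
  rw [doubleGraph, this, measureReal_prod_prod]

theorem randomSubgraph_forall_mem (T : Finset (Sym2 V)) (hT : (T : Set (Sym2 V)) ⊆ F.edgeSet) :
    (randomSubgraph F p).real {G | ∀ e ∈ T, e ∈ G.edgeSet} = (p : ℝ) ^ T.card := by
  rw [← doubleGraph_fst F p p,
    doubleGraph_forall F p p T (A := fun e => {e}) (E := fun e H => e ∈ H.1.edgeSet)]
  · rw [← Finset.prod_const]
    refine Finset.prod_congr rfl fun e he => ?_
    rw [doubleGraph_fst F p p (fun G => e ∈ G.edgeSet), randomSubgraph_edge F p (hT he)]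
  · exact fun e _ e' _ hne => by simpa [Function.onFun] using hne
  · exact fun e _ H H' h _ => propext (h e rfl)

theorem randomSubgraph_forall_notMem (T : Finset (Sym2 V)) (hT : (T : Set (Sym2 V)) ⊆ F.edgeSet) :
    (randomSubgraph F p).real {G | ∀ e ∈ T, e ∉ G.edgeSet} = (1 - p : ℝ) ^ T.card := by
  rw [← doubleGraph_fst F p p,
    doubleGraph_forall F p p T (A := fun e => {e}) (E := fun e H => e ∉ H.1.edgeSet)]
  · rw [← Finset.prod_const]
    refine Finset.prod_congr rfl fun e he => ?_
    rw [doubleGraph_fst F p p (fun G => e ∉ G.edgeSet)]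
    have := probReal_compl_eq_one_sub (μ := randomSubgraph F p) (s := {G | e ∈ G.edgeSet})
      .of_discrete
    rw [randomSubgraph_edge F p (hT he)] at this
    exact this
  · exact fun e _ e' _ hne => by simpa [Function.onFun] using hne
  · exact fun e _ H H' h _ => propext (not_congr (h e rfl))

theorem randomSubgraph_mem_eq_zero {e : Sym2 V} (he : e ∉ F.edgeSet) :
    (randomSubgraph F p).real {G | e ∈ G.edgeSet} = 0 := by
  have hΦ : Measurable (SimpleGraph.fromEdgeSet : Set (Sym2 V) → SimpleGraph V) :=
    SimpleGraph.measurable_fromEdgeSet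
  rw [randomSubgraph, map_measureReal_apply hΦ .of_discrete, measureReal_def,
    setBernoulli_apply_eq_apply_subsets]
  have : {s : Set (Sym2 V) | s ∈ SimpleGraph.fromEdgeSet ⁻¹' {G : SimpleGraph V | e ∈ G.edgeSet} ∧
      s ⊆ F.edgeSet} = ∅ := by
    ext s
    simp only [Set.mem_preimage, Set.mem_ofPred_eq, SimpleGraph.edgeSet_fromEdgeSet,
      Set.mem_empty_iff_false, iff_false]
    exact fun h => he (h.2 h.1.1)
  rw [this]; simp

end

/-! ### The deterministic process -/

section
variable {V : Type*} {R B : SimpleGraph V}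

/-- A partition that a step of the process leaves unchanged. The process on a finite vertex set
ends in a stable partition. -/
def IsStable (R B : SimpleGraph V) (s : Setoid V) : Prop := jigsawStep R B s = s

theorem le_jigsawStep (s : Setoid V) : s ≤ jigsawStep R B s := by
  intro u v h
  have : Quotient.mk s u = Quotient.mk s v := Quotient.sound h
  change (jigsawClusterGraph R B s).Reachable (Quotient.mk s u) (Quotient.mk s v)
  rw [this]

theorem percolates_of_forall_isStable [Finite V] (h : ∀ s, IsStable R B s → s = ⊤) :
    JigsawPercolates R B := by
  have hfin : Finite (Setoid V) :=
    Finite.of_injective (fun s : Setoid V => fun u v => s u v) fun s t hst =>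
      Setoid.ext fun u v => iff_of_eq (congrFun (congrFun hst u) v)
  have hmono : Monotone (jigsawClusters R B) :=
    monotone_nat_of_le_succ fun t => le_jigsawStep _
  obtain ⟨t, ht⟩ := WellFoundedGT.monotone_chain_condition ⟨jigsawClusters R B, hmono⟩
  exact ⟨t, h _ (ht (t + 1) (Nat.le_succ t)).symm⟩

theorem IsStable.rel {s : Setoid V} (hs : IsStable R B s) {a b u v x y : V}
    (hu : s a u) (hv : s b v) (huv : R.Adj u v) (hx : s a x) (hy : s b y) (hxy : B.Adj x y) :
    s a b := by
  by_contra hab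
  have hadj : (jigsawClusterGraph R B s).Adj (Quotient.mk s a) (Quotient.mk s b) :=
    ⟨fun h => hab (Quotient.exact h),
      ⟨u, v, (Quotient.sound hu).symm, (Quotient.sound hv).symm, huv⟩,
      ⟨x, y, (Quotient.sound hx).symm, (Quotient.sound hy).symm, hxy⟩⟩
  have : jigsawStep R B s a b := hadj.reachable
  rw [hs] at this
  exact hab this

/-- Vertex `w` sends a red and a blue edge to `S`. -/
def Attached (R B : SimpleGraph V) (S : Finset V) (w : V) : Prop :=
  (∃ u ∈ S, R.Adj u w) ∧ ∃ u ∈ S, B.Adj u w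

/-- The sets that can be built from a single vertex by successively adding attached vertices. Unlike
`Merged`, this depends only on the edges inside the set. -/
inductive Grown [DecidableEq V] (R B : SimpleGraph V) : Finset V → Prop
  | single (v : V) : Grown R B {v}
  | attach {S : Finset V} {w : V} (hS : Grown R B S) (hw : Attached R B S w) :
      Grown R B (insert w S)

/-- The vertices of `S` lie in one class of every stable partition. -/
def Merged (R B : SimpleGraph V) (S : Finset V) : Prop :=
  ∀ s, IsStable R B s → ∀ u ∈ S, ∀ v ∈ S, s u v

theorem Merged.attach [DecidableEq V] {S : Finset V} (hS : Merged R B S) {w : V}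
    (hw : Attached R B S w) : Merged R B (insert w S) := by
  intro s hs
  obtain ⟨⟨a, ha, haw⟩, b, hb, hbw⟩ := hw
  have key : ∀ u ∈ S, s u w := fun u hu =>
    hs.rel (hS s hs u hu a ha) (s.refl w) haw (hS s hs u hu b hb) (s.refl w) hbw
  intro u hu v hv
  rw [Finset.mem_insert] at hu hv
  rcases hu with rfl | hu <;> rcases hv with rfl | hv
  · exact s.refl _
  · exact s.symm (key v hv)
  · exact key u hu
  · exact hS s hs u hu v hv

theorem Grown.merged [DecidableEq V] {S : Finset V} (h : Grown R B S) : Merged R B S := by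
  induction h with
  | single v =>
    intro s _ u hu w hw
    rw [Finset.mem_singleton.1 hu, Finset.mem_singleton.1 hw]
  | attach _ hw ih => exact ih.attach hw

/-- No vertex of `K` outside `S` is attached to `S`. -/
def Stuck (R B : SimpleGraph V) (K S : Finset V) : Prop :=
  ∀ w ∈ K, w ∉ S → ¬ Attached R B S w

/-- A merged subset of `K` of maximal size is stuck in `K`, so it is all of `K` if large proper
subsets are not stuck. -/
theorem Merged.of_forall_not_stuck [DecidableEq V] {K S : Finset V} (hS : Merged R B S)
    (hSK : S ⊆ K) (h : ∀ T ⊂ K, S.card ≤ T.card → ¬ Stuck R B K T) : Merged R B K := by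
  classical
  let P := K.powerset.filter fun T => S.card ≤ T.card ∧ Merged R B T
  obtain ⟨T, hT, hmax⟩ := P.exists_max_image Finset.card ⟨S, by simp [P, hSK, hS]⟩
  simp only [P, Finset.mem_filter, Finset.mem_powerset] at hT hmax
  obtain ⟨hTK, hcard, hTm⟩ := hT
  rcases hTK.eq_or_ssubset with rfl | hss
  · exact hTm
  · have := h T hss hcard
    simp only [Stuck, not_forall, not_not] at this
    obtain ⟨w, hwK, hwT, hw⟩ := this
    have := hmax (insert w T) ⟨Finset.insert_subset hwK hTK,
      hcard.trans (Finset.card_le_card (Finset.subset_insert _ _)), hTm.attach hw⟩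
    rw [Finset.card_insert_of_notMem hwT] at this
    omega

/-- The red and the blue graph induced on `S` are both connected. -/
def DoublyConnected (R B : SimpleGraph V) (S : Finset V) : Prop :=
  (R.induce (S : Set V)).Connected ∧ (B.induce (S : Set V)).Connected

theorem DoublyConnected.union [DecidableEq V] {S T : Finset V} (hS : DoublyConnected R B S)
    (hT : DoublyConnected R B T) {u v x y : V} (hu : u ∈ S) (hv : v ∈ T) (huv : R.Adj u v)
    (hx : x ∈ S) (hy : y ∈ T) (hxy : B.Adj x y) : DoublyConnected R B (S ∪ T) := by
  constructor
  · rw [Finset.coe_union]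
    exact SimpleGraph.connected_induce_union hS.1.preconnected hT.1.preconnected hu hv huv
  · rw [Finset.coe_union]
    exact SimpleGraph.connected_induce_union hS.2.preconnected hT.2.preconnected hx hy hxy

theorem doublyConnected_singleton (v : V) : DoublyConnected R B {v} := by
  constructor <;>
  · rw [Finset.coe_singleton]
    exact SimpleGraph.Connected.of_subsingleton

/-- If there is no doubly connected set of size in `[k, 2k)`, then all clusters stay smaller than
`k`: adding one cluster of the previous time at a time to a part of a new cluster, the size never
jumps over `[k, 2k)`. -/
theorem JigsawPercolates.exists_doublyConnected [Fintype V] (h : JigsawPercolates R B)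
    {k : ℕ} (hk : 1 ≤ k) (hkV : k ≤ Fintype.card V) :
    ∃ S : Finset V, k ≤ S.card ∧ S.card < 2 * k ∧ DoublyConnected R B S := by
  classical
  by_contra hcon
  have hsmall : ∀ S : Finset V, S.card < 2 * k → DoublyConnected R B S → S.card < k := by
    intro S h1 h2
    by_contra h3
    exact hcon ⟨S, not_lt.1 h3, h1, h2⟩
  let cls (s : Setoid V) (u : V) : Finset V := {v | s u v}
  have hcls : ∀ t u, DoublyConnected R B (cls (jigsawClusters R B t) u) ∧
      (cls (jigsawClusters R B t) u).card < k := by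
    intro t
    induction t with
    | zero =>
      intro u
      have : cls (jigsawClusters R B 0) u = {u} := by
        ext v
        simp only [cls, Finset.mem_filter, Finset.mem_univ, true_and, Finset.mem_singleton]
        exact eq_comm
      rw [this]
      exact ⟨doublyConnected_singleton u,
        hsmall _ (by simp; omega) (doublyConnected_singleton u)⟩
    | succ t ih =>
      intro u
      set s := jigsawClusters R B t with hs
      have hmem : ∀ (s : Setoid V) (a b : V), b ∈ cls s a ↔ s a b := by simp [cls]
      let P : Finset (Finset V) := Finset.univ.filter fun S => u ∈ S ∧ DoublyConnected R B S ∧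
        S.card < k ∧ (∀ a ∈ S, ∀ b, s a b → b ∈ S) ∧ S ⊆ cls (jigsawStep R B s) u
      -- a largest union of old clusters inside the new cluster of `u` that is doubly connected and
      -- smaller than `k`; it turns out to be the whole new cluster
      obtain ⟨S, hS, hmax⟩ := P.exists_max_image Finset.card ⟨cls s u, by
        simp only [P, Finset.mem_filter, Finset.mem_univ, true_and, hmem]
        refine ⟨s.refl u, (ih u).1, (ih u).2, fun a ha b hb => s.trans ha hb, fun a ha => ?_⟩
        rw [hmem] at ha ⊢
        exact le_jigsawStep s ha⟩
      simp only [P, Finset.mem_filter, Finset.mem_univ, true_and] at hS hmax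
      obtain ⟨huS, hSc, hSk, hScl, hSs⟩ := hS
      have hall : ∀ D, (jigsawClusterGraph R B s).Reachable (Quotient.mk s u) D →
          ∀ w, Quotient.mk s w = D → w ∈ S := by
        intro D hD
        rw [SimpleGraph.reachable_iff_reflTransGen] at hD
        induction hD with
        | refl => exact fun w hw => hScl u huS w (s.symm (Quotient.exact hw))
        | @tail C D hC hCD ihC =>
          intro w hw
          by_contra hwS
          obtain ⟨hne, ⟨a, b, ha, hb, hab⟩, x, y, hx, hy, hxy⟩ := hCD
          have hdc : DoublyConnected R B (S ∪ cls s w) :=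
            hSc.union (ih w).1 (ihC a ha) ((hmem _ _ _).2 (Quotient.exact (hw.trans hb.symm))) hab
              (ihC x hx) ((hmem _ _ _).2 (Quotient.exact (hw.trans hy.symm))) hxy
          have hlt : (S ∪ cls s w).card < 2 * k := by
            have := Finset.card_union_le S (cls s w)
            have := (ih w).2
            omega
          have hle := hmax (S ∪ cls s w)
            ⟨Finset.mem_union_left _ huS, hdc, hsmall _ hlt hdc, ?_, ?_⟩
          · have : S ⊂ S ∪ cls s w :=
              Finset.ssubset_iff_subset_ne.2 ⟨Finset.subset_union_left, fun h => hwS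
                (h ▸ Finset.mem_union_right _ ((hmem _ _ _).2 (s.refl w)))⟩
            exact absurd (Finset.card_lt_card this) (not_lt.2 hle)
          · intro c hc d hcd
            rcases Finset.mem_union.1 hc with hc | hc
            · exact Finset.mem_union_left _ (hScl c hc d hcd)
            · exact Finset.mem_union_right _ ((hmem _ _ _).2 (s.trans ((hmem _ _ _).1 hc) hcd))
          · refine Finset.union_subset hSs fun c hc => (hmem _ _ _).2 ?_
            have hDc : Quotient.mk s c = D :=
              (Quotient.sound (s.symm ((hmem _ _ _).1 hc))).trans hw
            change (jigsawClusterGraph R B s).Reachable (Quotient.mk s u) (Quotient.mk s c)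
            rw [hDc, SimpleGraph.reachable_iff_reflTransGen]
            exact hC.tail ⟨hne, ⟨a, b, ha, hb, hab⟩, x, y, hx, hy, hxy⟩
      have heq : cls (jigsawClusters R B (t + 1)) u = S := by
        refine subset_antisymm (fun w hw => ?_) hSs
        exact hall _ ((hmem _ _ _).1 hw) w rfl
      rw [heq]
      exact ⟨hSc, hSk⟩
  obtain ⟨t, ht⟩ := h
  have hV : Nonempty V := Fintype.card_pos_iff.1 (hk.trans hkV)
  have := (hcls t hV.some).2
  have huniv : cls (jigsawClusters R B t) hV.some = Finset.univ := by
    ext v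
    simp only [cls, ht, Finset.mem_filter, Finset.mem_univ, true_and, iff_true]
    trivial
  rw [huniv, Finset.card_univ] at this
  omega

/-- A breadth-first spanning tree with root `r`: `f` is the parent map, `ρ` the distance to `r`. -/
theorem exists_parent {W : Type*} {G : SimpleGraph W} (hG : G.Connected) (r : W) :
    ∃ (f : W → W) (ρ : W → ℕ), ∀ u, u ≠ r → G.Adj u (f u) ∧ ρ (f u) < ρ u := by
  have : ∀ u, ∃ w, u ≠ r → G.Adj u w ∧ G.dist w r < G.dist u r := by
    intro u
    by_cases hu : u = r
    · exact ⟨u, fun h => absurd hu h⟩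
    · obtain ⟨p, hp⟩ := hG.exists_walk_length_eq_dist u r
      cases p with
      | nil => exact absurd rfl hu
      | @cons _ w _ h p =>
        refine ⟨w, fun _ => ⟨h, ?_⟩⟩
        have := SimpleGraph.dist_le p
        rw [← hp, SimpleGraph.Walk.length_cons]
        omega
  choose f hf using this
  exact ⟨f, fun u => G.dist u r, hf⟩

end

/-! ### Growth inside a clique -/

section
variable {V : Type*}

/-- The possible edges between vertices of `K`. Loops are left out, so that the inner edges of two
sets that share one vertex are disjoint. -/
def innerEdges (K : Finset V) : Set (Sym2 V) := {e | ¬ e.IsDiag ∧ ∀ v ∈ e, v ∈ K}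

theorem AgreeOn.attached {K S : Finset V} {w : V} {R B R' B' : SimpleGraph V}
    (hR : AgreeOn (innerEdges K) R R') (hB : AgreeOn (innerEdges K) B B') (hS : S ⊆ K)
    (hw : w ∈ K) (h : Attached R B S w) : Attached R' B' S w := by
  have key : ∀ {G G' : SimpleGraph V} {u : V}, AgreeOn (innerEdges K) G G' → u ∈ S → G.Adj u w →
      G'.Adj u w := by
    intro G G' u hG hu huw
    refine (hG s(u, w) ⟨by simpa using huw.ne, fun v hv => ?_⟩).1 huw
    rcases Sym2.mem_iff.1 hv with rfl | rfl
    exacts [hS hu, hw]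
  obtain ⟨⟨u, hu, huw⟩, v, hv, hvw⟩ := h
  exact ⟨⟨u, hu, key hR hu huw⟩, v, hv, key hB hv hvw⟩

theorem AgreeOn.grown [DecidableEq V] {K S : Finset V} {R B R' B' : SimpleGraph V}
    (hR : AgreeOn (innerEdges K) R R') (hB : AgreeOn (innerEdges K) B B') (hS : S ⊆ K)
    (h : Grown R B S) : Grown R' B' S := by
  induction h with
  | single v => exact .single v
  | attach _ hw ih =>
    have h1 := (Finset.subset_insert _ _).trans hS
    exact .attach (ih h1) (hR.attached hB h1 (hS (Finset.mem_insert_self _ _)) hw)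

/-- The set `K` contains a grown set with `M` vertices. -/
def HasGrown [DecidableEq V] (R B : SimpleGraph V) (K : Finset V) (M : ℕ) : Prop :=
  ∃ S, S ⊆ K ∧ S.card = M ∧ Grown R B S

theorem determinedOn_grown [DecidableEq V] (K : Finset V) (M : ℕ) :
    DeterminedOn (innerEdges K)
      (fun H => {S : Finset V | S ⊆ K ∧ S.card = M ∧ Grown H.1 H.2 S}) := by
  intro H H' h1 h2
  ext S
  exact ⟨fun h => ⟨h.1, h.2.1, h1.grown h2 h.1 h.2.2⟩,
    fun h => ⟨h.1, h.2.1, h1.symm.grown h2.symm h.1 h.2.2⟩⟩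

theorem determinedOn_hasGrown [DecidableEq V] (K : Finset V) (M : ℕ) :
    DeterminedOn (innerEdges K) (fun H => HasGrown H.1 H.2 K M) :=
  (determinedOn_grown K M).comp Set.Nonempty

/-- The possible edges from `w` to `S`. -/
def spokes (S : Finset V) (w : V) : Set (Sym2 V) := {e | ∃ u ∈ S, e = s(u, w)}

theorem determinedOn_attached (S : Finset V) (w : V) :
    DeterminedOn (spokes S w) (fun H => Attached H.1 H.2 S w) := by
  intro H H' h1 h2
  have a1 : ∀ u ∈ S, (H.1.Adj u w ↔ H'.1.Adj u w) := fun u hu => h1 s(u, w) ⟨u, hu, rfl⟩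
  have a2 : ∀ u ∈ S, (H.2.Adj u w ↔ H'.2.Adj u w) := fun u hu => h2 s(u, w) ⟨u, hu, rfl⟩
  refine propext (and_congr ?_ ?_)
  · exact exists_congr fun u => and_congr_right fun hu => a1 u hu
  · exact exists_congr fun u => and_congr_right fun hu => a2 u hu

theorem disjoint_spokes {S : Finset V} {w w' : V} (hw : w ∉ S) (hne : w ≠ w') :
    Disjoint (spokes S w) (spokes S w') := by
  rw [Set.disjoint_left]
  rintro e ⟨u, hu, rfl⟩ ⟨u', hu', h⟩
  rcases Sym2.eq_iff.1 h with ⟨-, h⟩ | ⟨-, h⟩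
  · exact hne h
  · exact hw (h ▸ hu')

/-- The probability that a vertex is attached to a set of `k` of its neighbours. -/
noncomputable def attachProb (p q : ℝ) (k : ℕ) : ℝ := (1 - (1 - p) ^ k) * (1 - (1 - q) ^ k)

theorem attachProb_nonneg (p q : unitInterval) (k : ℕ) : 0 ≤ attachProb p q k :=
  mul_nonneg (sub_nonneg.2 (pow_le_one₀ (unitInterval.one_minus_nonneg p)
    (unitInterval.one_minus_le_one p))) (sub_nonneg.2 (pow_le_one₀ (unitInterval.one_minus_nonneg q)
    (unitInterval.one_minus_le_one q)))

theorem attachProb_le_one (p q : unitInterval) (k : ℕ) : attachProb p q k ≤ 1 :=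
  mul_le_one₀ (sub_le_self _ (pow_nonneg (unitInterval.one_minus_nonneg p) _))
    (sub_nonneg.2 (pow_le_one₀ (unitInterval.one_minus_nonneg q)
    (unitInterval.one_minus_le_one q)))
    (sub_le_self _ (pow_nonneg (unitInterval.one_minus_nonneg q) _))

variable [Finite V] {F : SimpleGraph V} (p q : unitInterval)

theorem doubleGraph_attached {S : Finset V} {w : V} (hF : ∀ u ∈ S, F.Adj u w) :
    (doubleGraph F p q).real {H | Attached H.1 H.2 S w} = attachProb p q S.card := by
  classical
  have key : ∀ r : unitInterval, (randomSubgraph F r).real {G | ∃ u ∈ S, G.Adj u w} =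
      1 - (1 - r) ^ S.card := by
    intro r
    have h1 : {G : SimpleGraph V | ∃ u ∈ S, G.Adj u w} =
        {G | ∀ e ∈ S.image (fun u => s(u, w)), e ∉ G.edgeSet}ᶜ := by
      ext G; simp
    have hinj : Function.Injective (fun u => s(u, w)) := fun u v h => Sym2.congr_left.1 h
    rw [h1, probReal_compl_eq_one_sub .of_discrete, randomSubgraph_forall_notMem,
      Finset.card_image_of_injective _ hinj]
    intro e he
    simp only [Finset.coe_image, Set.mem_image, Finset.mem_coe] at he
    obtain ⟨u, hu, rfl⟩ := he
    exact hF u hu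
  exact (doubleGraph_and F p q (fun G => ∃ u ∈ S, G.Adj u w) (fun G => ∃ u ∈ S, G.Adj u w)).trans
    (by rw [key, key]; rfl)

theorem doubleGraph_forall_not_attached {S W : Finset V} (hSW : Disjoint S W)
    (hF : ∀ u ∈ S, ∀ w ∈ W, F.Adj u w) :
    (doubleGraph F p q).real {H | ∀ w ∈ W, ¬ Attached H.1 H.2 S w} =
      (1 - attachProb p q S.card) ^ W.card := by
  rw [doubleGraph_forall F p q W (A := fun w => spokes S w)
    (E := fun w H => ¬ Attached H.1 H.2 S w), ← Finset.prod_const]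
  · refine Finset.prod_congr rfl fun w hw => ?_
    rw [← doubleGraph_attached p q fun u hu => hF u hu w hw]
    exact probReal_compl_eq_one_sub .of_discrete
  · exact fun w hw w' _ hne => disjoint_spokes (Finset.disjoint_right.1 hSW hw) hne
  · exact fun w _ => (determinedOn_attached S w).comp Not

/-- One growth step. Given a grown set `S ⊆ K` of size `M`, chosen by looking only at the edges
inside `K`, the edges between `S` and the fresh block `W` are still independent of what was seen. -/
theorem hasGrown_step [DecidableEq V] {K W : Finset V} (hKW : Disjoint K W)
    (hF : ∀ u ∈ K, ∀ w ∈ W, F.Adj u w) (M : ℕ) :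
    (doubleGraph F p q).real {H | HasGrown H.1 H.2 K M} *
        (1 - (1 - attachProb p q M) ^ W.card) ≤
      (doubleGraph F p q).real {H | HasGrown H.1 H.2 (K ∪ W) (M + 1)} := by
  classical
  set μ := doubleGraph F p q
  -- a choice of a grown set that depends only on the family of all grown sets
  let pick (T : Set (Finset V)) : Finset V := if h : T.Nonempty then h.some else ∅
  let fam (H : SimpleGraph V × SimpleGraph V) : Set (Finset V) :=
    {S | S ⊆ K ∧ S.card = M ∧ Grown H.1 H.2 S}
  let E (S : Finset V) (H : SimpleGraph V × SimpleGraph V) : Prop :=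
    (fam H).Nonempty ∧ pick (fam H) = S
  let 𝒮 := K.powersetCard M
  have hpick : ∀ H, (fam H).Nonempty → pick (fam H) ∈ fam H := by
    intro H h
    simp only [pick, h, dif_pos]
    exact h.some_mem
  have h1 : μ.real {H | HasGrown H.1 H.2 K M} = ∑ S ∈ 𝒮, μ.real {H | E S H} := by
    rw [← measureReal_biUnion_finset]
    · congr 1
      ext H
      simp only [Set.mem_iUnion, Set.mem_ofPred_eq, exists_prop]
      constructor
      · intro h
        have := hpick H h
        exact ⟨pick (fam H), Finset.mem_powersetCard.2 ⟨this.1, this.2.1⟩, h, rfl⟩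
      · rintro ⟨S, -, h, -⟩
        exact h
    · intro S _ T _ hne
      refine Set.disjoint_left.2 fun H hS hT => hne (hS.2.symm.trans hT.2)
    · exact fun _ _ => .of_discrete
  have h2 : ∀ S ∈ 𝒮, μ.real {H | E S H} * (1 - (1 - attachProb p q M) ^ W.card) =
      μ.real {H | E S H ∧ ¬ ∀ w ∈ W, ¬ Attached H.1 H.2 S w} := by
    intro S hS
    obtain ⟨hSK, hSM⟩ := Finset.mem_powersetCard.1 hS
    have hdisj : Disjoint (innerEdges K) (⋃ w ∈ (W : Set V), spokes S w) := by
      rw [Set.disjoint_iUnion₂_right]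
      intro w hw
      rw [Set.disjoint_left]
      rintro _ ⟨-, h⟩ ⟨u, -, rfl⟩
      exact Finset.disjoint_right.1 hKW hw (h w (by simp))
    rw [doubleGraph_inter F p q hdisj (E := E S)
      (E' := fun H => ¬ ∀ w ∈ W, ¬ Attached H.1 H.2 S w)]
    · congr 1
      rw [← hSM, ← doubleGraph_forall_not_attached p q (hKW.mono_left hSK)
        fun u hu w hw => hF u (hSK hu) w hw]
      exact (probReal_compl_eq_one_sub .of_discrete).symm
    · exact (determinedOn_grown K M).comp fun T => T.Nonempty ∧ pick T = S
    · have := DeterminedOn.forall_mem (s := (W : Set V)) (A := fun w => spokes S w)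
        (E := fun w H => ¬ Attached H.1 H.2 S w)
        fun w _ => (determinedOn_attached S w).comp Not
      exact this.comp Not
  rw [h1, Finset.sum_mul, Finset.sum_congr rfl h2, ← measureReal_biUnion_finset]
  · refine measureReal_mono ?_
    intro H hH
    simp only [Set.mem_iUnion, Set.mem_ofPred_eq, exists_prop, not_forall, not_not] at hH ⊢
    obtain ⟨S, -, ⟨hne, hS⟩, w, hw, hatt⟩ := hH
    have hmem := hpick H hne
    rw [hS] at hmem
    refine ⟨insert w S, ?_, ?_, hmem.2.2.attach hatt⟩
    · exact Finset.insert_subset (Finset.mem_union_right _ hw)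
        (hmem.1.trans Finset.subset_union_left)
    · rw [Finset.card_insert_of_notMem fun h => Finset.disjoint_right.1 hKW hw (hmem.1 h),
        hmem.2.1]
  · intro S _ T _ hne
    exact Set.disjoint_left.2 fun H hS hT => hne (hS.1.2.symm.trans hT.1.2)
  · exact fun _ _ => .of_discrete

/-- Growing a set inside a clique, with a fresh block of `N i` vertices for the step from size
`i + 1` to size `i + 2`. -/
theorem prod_le_hasGrown [DecidableEq V] (N : ℕ → ℕ) (M : ℕ) : ∀ {K : Finset V},
    (∀ u ∈ K, ∀ w ∈ K, u ≠ w → F.Adj u w) → 1 + ∑ i ∈ Finset.range M, N i ≤ K.card →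
    ∏ i ∈ Finset.range M, (1 - (1 - attachProb p q (i + 1)) ^ N i) ≤
      (doubleGraph F p q).real {H | HasGrown H.1 H.2 K (M + 1)} := by
  induction M with
  | zero =>
    intro K _ hK
    obtain ⟨v, hv⟩ := Finset.card_pos.1 (by simpa using hK : 0 < K.card)
    have : {H : SimpleGraph V × SimpleGraph V | HasGrown H.1 H.2 K (0 + 1)} = Set.univ := by
      ext H
      simp only [Set.mem_ofPred_eq, Set.mem_univ, iff_true]
      exact ⟨{v}, by simpa using hv, by simp, .single v⟩
    rw [this]; simp
  | succ M ih =>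
    intro K hF hK
    rw [Finset.sum_range_succ] at hK
    obtain ⟨W, hWK, hW⟩ := Finset.exists_subset_card_eq (by omega : N M ≤ K.card)
    have hcard : (K \ W).card = K.card - N M := by rw [Finset.card_sdiff_of_subset hWK, hW]
    have hstep := hasGrown_step (F := F) p q (Finset.sdiff_disjoint (s := W) (t := K))
      (fun u hu w hw => hF u (Finset.mem_sdiff.1 hu).1 w (hWK hw)
        (fun h => (Finset.mem_sdiff.1 hu).2 (h ▸ hw))) (M + 1)
    rw [Finset.sdiff_union_of_subset hWK, hW] at hstep
    rw [Finset.prod_range_succ]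
    refine le_trans (mul_le_mul_of_nonneg_right (ih (K := K \ W) ?_ (by omega)) ?_) hstep
    · exact fun u hu w hw => hF u (Finset.mem_sdiff.1 hu).1 w (Finset.mem_sdiff.1 hw).1
    · refine sub_nonneg.2 (pow_le_one₀ (sub_nonneg.2 (attachProb_le_one p q _)) ?_)
      exact sub_le_self _ (attachProb_nonneg p q _)

theorem stuck_prob {K S : Finset V} (hF : ∀ u ∈ K, ∀ w ∈ K, u ≠ w → F.Adj u w) (hS : S ⊆ K) :
    (doubleGraph F p q).real {H | Stuck H.1 H.2 K S} =
      (1 - attachProb p q S.card) ^ (K.card - S.card) := by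
  classical
  rw [← Finset.card_sdiff_of_subset hS,
    ← doubleGraph_forall_not_attached p q (F := F) Finset.disjoint_sdiff]
  · congr 1
    ext H
    simp [Stuck]
  · exact fun u hu w hw => hF u (hS hu) w (Finset.mem_sdiff.1 hw).1
      fun h => (Finset.mem_sdiff.1 hw).2 (h ▸ hu)

theorem exists_stuck_prob_le {K : Finset V} (hF : ∀ u ∈ K, ∀ w ∈ K, u ≠ w → F.Adj u w) (k₀ : ℕ) :
    (doubleGraph F p q).real {H | ∃ S, S ⊂ K ∧ k₀ ≤ S.card ∧ Stuck H.1 H.2 K S} ≤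
      ∑ k ∈ Finset.Ico k₀ K.card,
        (K.card.choose k : ℝ) * (1 - attachProb p q k) ^ (K.card - k) := by
  have hsub : {H : SimpleGraph V × SimpleGraph V | ∃ S, S ⊂ K ∧ k₀ ≤ S.card ∧ Stuck H.1 H.2 K S} ⊆
      ⋃ k ∈ Finset.Ico k₀ K.card, ⋃ S ∈ K.powersetCard k, {H | Stuck H.1 H.2 K S} := by
    rintro H ⟨S, hSK, hk, hst⟩
    simp only [Set.mem_iUnion, exists_prop, Finset.mem_Ico, Finset.mem_powersetCard]
    exact ⟨S.card, ⟨hk, Finset.card_lt_card hSK⟩, S, ⟨hSK.subset, rfl⟩, hst⟩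
  refine (measureReal_mono hsub (measure_ne_top _ _)).trans
    ((measureReal_biUnion_finset_le _ _).trans ?_)
  refine Finset.sum_le_sum fun k _ => (measureReal_biUnion_finset_le _ _).trans (le_of_eq ?_)
  rw [← Finset.card_powersetCard, ← nsmul_eq_mul, ← Finset.sum_const]
  refine Finset.sum_congr rfl fun S hS => ?_
  obtain ⟨h1, h2⟩ := Finset.mem_powersetCard.1 hS
  rw [stuck_prob p q hF h1, h2]

end

/-! ### Stars -/

section
variable {n : ℕ}

/-- The star of `x`: the pairs that contain `x`. -/
def star (x : Fin n) : Finset (TwoSets n) := {e | x ∈ e.1}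

/-- The pair `{x, y}`, the only common vertex of the stars of `x` and `y`. -/
def pairOf (x y : Fin n) (h : x ≠ y) : TwoSets n := ⟨{x, y}, Finset.card_pair h⟩

theorem mem_star {x : Fin n} {e : TwoSets n} : e ∈ star x ↔ x ∈ e.1 := by simp [star]

theorem pairOf_mem_left (x y : Fin n) (h : x ≠ y) : pairOf x y h ∈ star x := by
  simp [mem_star, pairOf]

theorem pairOf_mem_right (x y : Fin n) (h : x ≠ y) : pairOf x y h ∈ star y := by
  simp [mem_star, pairOf]

theorem eq_pairOf {x y : Fin n} (h : x ≠ y) {e : TwoSets n} (hx : e ∈ star x) (hy : e ∈ star y) :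
    e = pairOf x y h := by
  rw [mem_star] at hx hy
  refine Subtype.ext (Finset.eq_of_subset_of_card_le ?_ ?_).symm
  · exact Finset.insert_subset hx (Finset.singleton_subset_iff.2 hy)
  · rw [e.2]; exact (pairOf x y h).2.ge

theorem exists_mem_star (e : TwoSets n) : ∃ x, e ∈ star x := by
  have : e.1.Nonempty := by
    rw [← Finset.card_pos, e.2]; norm_num
  exact ⟨_, mem_star.2 this.choose_spec⟩

theorem exists_eq_pairOf {x : Fin n} {e : TwoSets n} (he : e ∈ star x) :
    ∃ y, ∃ h : x ≠ y, e = pairOf x y h := by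
  obtain ⟨y, hy, hyx⟩ := Finset.exists_mem_ne (by rw [e.2]; norm_num : 1 < e.1.card) x
  exact ⟨y, hyx.symm, eq_pairOf hyx.symm he (mem_star.2 hy)⟩

theorem pairOf_right_injective {x y y' : Fin n} {h : x ≠ y} {h' : x ≠ y'}
    (heq : pairOf x y h = pairOf x y' h') : y = y' := by
  have := pairOf_mem_right x y h
  rw [heq, mem_star] at this
  simp only [pairOf, Finset.mem_insert, Finset.mem_singleton] at this
  exact this.resolve_left h.symm

theorem card_star (x : Fin n) : (star x).card = n - 1 := by
  have h : (star x) = (Finset.univ.erase x).attach.image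
      fun y => pairOf x y.1 (Finset.ne_of_mem_erase y.2).symm := by
    ext e
    simp only [Finset.mem_image, Finset.mem_attach, true_and, Subtype.exists]
    constructor
    · intro he
      obtain ⟨y, hy, rfl⟩ := exists_eq_pairOf he
      exact ⟨y, Finset.mem_erase.2 ⟨hy.symm, Finset.mem_univ _⟩, rfl⟩
    · rintro ⟨y, hy, rfl⟩
      exact pairOf_mem_left _ _ _
  rw [h, Finset.card_image_of_injective _ fun y y' hyy => Subtype.ext (pairOf_right_injective hyy),
    Finset.card_attach, Finset.card_erase_of_mem (Finset.mem_univ x), Finset.card_univ,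
    Fintype.card_fin]

theorem star_adj (x : Fin n) : ∀ u ∈ star x, ∀ w ∈ star x, u ≠ w → (intersectingPairs n).Adj u w :=
  fun _ hu _ hw hne => ⟨hne, x, Finset.mem_inter.2 ⟨mem_star.1 hu, mem_star.1 hw⟩⟩

theorem disjoint_innerEdges_star {x y : Fin n} (h : x ≠ y) :
    Disjoint (innerEdges (star x)) (innerEdges (star y)) := by
  rw [Set.disjoint_left]
  rintro e ⟨hd, hx⟩ ⟨-, hy⟩
  induction e with
  | _ u v =>
    refine hd ?_
    rw [Sym2.mk_isDiag_iff,
      eq_pairOf h (hx u (Sym2.mem_mk_left u v)) (hy u (Sym2.mem_mk_left u v)),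
      eq_pairOf h (hx v (Sym2.mem_mk_right u v)) (hy v (Sym2.mem_mk_right u v))]

/-- Suppose that stars have no large stuck subsets. The stars with centre in `X` are merged, and any
two of them share a vertex. Every other star contains the vertices `{x, y}`, `x ∈ X`, so it is
merged, too. -/
theorem percolates_of_stars {R B : SimpleGraph (TwoSets n)} {k₀ : ℕ}
    (hstuck : ∀ x : Fin n, ∀ S, S ⊂ star x → k₀ ≤ S.card → ¬ Stuck R B (star x) S)
    {X : Finset (Fin n)} (hX : k₀ < X.card) (hnuc : ∀ x ∈ X, HasGrown R B (star x) k₀) :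
    JigsawPercolates R B := by
  classical
  have hstar : ∀ x ∈ X, Merged R B (star x) := by
    intro x hx
    obtain ⟨S, hS, hcard, hg⟩ := hnuc x hx
    exact hg.merged.of_forall_not_stuck hS fun T hT hle => hstuck x T hT (hcard ▸ hle)
  have hall : ∀ y, Merged R B (star y) := by
    intro y
    let S : Finset (TwoSets n) := (X.erase y).attach.image
      fun x => pairOf y x.1 (Finset.ne_of_mem_erase x.2).symm
    have hSy : S ⊆ star y := by
      intro e he
      obtain ⟨x, -, rfl⟩ := Finset.mem_image.1 he
      exact pairOf_mem_left _ _ _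
    have hcard : k₀ ≤ S.card := by
      rw [Finset.card_image_of_injective _ fun x x' h => Subtype.ext (pairOf_right_injective h),
        Finset.card_attach]
      have := Finset.pred_card_le_card_erase (s := X) (a := y)
      omega
    have hSm : Merged R B S := by
      intro s hs u hu v hv
      obtain ⟨⟨x, hx⟩, -, rfl⟩ := Finset.mem_image.1 hu
      obtain ⟨⟨x', hx'⟩, -, rfl⟩ := Finset.mem_image.1 hv
      by_cases hxx : x = x'
      · subst hxx; exact s.refl _
      · exact s.trans
          (hstar x (Finset.mem_of_mem_erase hx) s hs _ (pairOf_mem_right _ _ _)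
            (pairOf x x' hxx) (pairOf_mem_left _ _ _))
          (hstar x' (Finset.mem_of_mem_erase hx') s hs _ (pairOf_mem_right _ _ _)
            _ (pairOf_mem_right _ _ _))
    exact hSm.of_forall_not_stuck hSy fun T hT hle => hstuck y T hT (hcard.trans hle)
  refine percolates_of_forall_isStable fun s hs => ?_
  refine Setoid.eq_top_iff.2 fun e f => ?_
  obtain ⟨x, hx⟩ := exists_mem_star e
  obtain ⟨y, hy⟩ := exists_mem_star f
  by_cases hxy : x = y
  · subst hxy; exact hall x s hs e hx f hy
  · exact s.trans (hall x s hs e hx _ (pairOf_mem_left x y hxy))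
      (hall y s hs _ (pairOf_mem_right x y hxy) f hy)

/-- Union bound over the stuck sets, and over the sets of `n - k₀` centres whose stars all fail to
contain a grown set of size `k₀`. -/
theorem not_percolates_prob_le (p q : unitInterval) {k₀ : ℕ} (hk₀ : k₀ ≤ n) {θ : ℝ}
    (hnuc : ∀ x : Fin n, θ ≤ (doubleGraph (intersectingPairs n) p q).real
      {H | HasGrown H.1 H.2 (star x) k₀}) :
    (doubleGraph (intersectingPairs n) p q).real {H | ¬ JigsawPercolates H.1 H.2} ≤
      n * ∑ k ∈ Finset.Ico k₀ (n - 1),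
        ((n - 1).choose k : ℝ) * (1 - attachProb p q k) ^ (n - 1 - k) +
      n.choose k₀ * (1 - θ) ^ (n - k₀) := by
  classical
  set μ := doubleGraph (intersectingPairs n) p q
  have hsub : {H : SimpleGraph (TwoSets n) × SimpleGraph (TwoSets n) |
      ¬ JigsawPercolates H.1 H.2} ⊆
      (⋃ x ∈ (Finset.univ : Finset (Fin n)),
        {H | ∃ S, S ⊂ star x ∧ k₀ ≤ S.card ∧ Stuck H.1 H.2 (star x) S}) ∪
      ⋃ T ∈ (Finset.univ : Finset (Fin n)).powersetCard (n - k₀),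
        {H | ∀ x ∈ T, ¬ HasGrown H.1 H.2 (star x) k₀} := by
    intro H hH
    by_contra hcon
    simp only [Set.mem_union, Set.mem_iUnion, exists_prop, Finset.mem_univ, true_and,
      Set.mem_ofPred_eq, not_or, not_exists, not_and] at hcon
    obtain ⟨h1, h2⟩ := hcon
    let X : Finset (Fin n) := {x | HasGrown H.1 H.2 (star x) k₀}
    refine hH (percolates_of_stars (k₀ := k₀) (X := X) h1 ?_ fun x hx => by simpa [X] using hx)
    by_contra hX
    have : n - k₀ ≤ (Xᶜ).card := by
      rw [Finset.card_compl, Fintype.card_fin]; omega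
    obtain ⟨T, hT, hTc⟩ := Finset.exists_subset_card_eq this
    exact h2 T (Finset.mem_powersetCard.2 ⟨Finset.subset_univ _, hTc⟩)
      fun x hx => by simpa [X] using hT hx
  refine (measureReal_mono hsub (measure_ne_top _ _)).trans ((measureReal_union_le _ _).trans ?_)
  refine add_le_add ?_ ?_
  · refine (measureReal_biUnion_finset_le _ _).trans ?_
    refine (Finset.sum_le_card_nsmul _ _ (∑ k ∈ Finset.Ico k₀ (n - 1),
        ((n - 1).choose k : ℝ) * (1 - attachProb p q k) ^ (n - 1 - k)) fun x _ => ?_).trans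
      (le_of_eq ?_)
    · have := exists_stuck_prob_le p q (star_adj x) k₀
      rwa [card_star] at this
    · simp
  · refine (measureReal_biUnion_finset_le _ _).trans ?_
    refine (Finset.sum_le_card_nsmul _ _ ((1 - θ) ^ (n - k₀)) fun T hT => ?_).trans
      (le_of_eq ?_)
    · rw [doubleGraph_forall _ p q T (A := fun x => innerEdges (star x))
        (E := fun x H => ¬ HasGrown H.1 H.2 (star x) k₀)
        (fun x _ y _ hne => disjoint_innerEdges_star hne)
        (fun x _ => (determinedOn_hasGrown _ _).comp Not),
        ← (Finset.mem_powersetCard.1 hT).2, ← Finset.prod_const]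
      refine Finset.prod_le_prod (fun _ _ => measureReal_nonneg) fun x _ => ?_
      have := probReal_compl_eq_one_sub (μ := μ) (s := {H | HasGrown H.1 H.2 (star x) k₀})
        .of_discrete
      calc μ.real {H | ¬ HasGrown H.1 H.2 (star x) k₀} =
          1 - μ.real {H | HasGrown H.1 H.2 (star x) k₀} := this
        _ ≤ 1 - θ := sub_le_sub_left (hnuc x) 1
    · rw [Finset.card_powersetCard, Finset.card_univ, Fintype.card_fin, nsmul_eq_mul,
        Nat.choose_symm hk₀]

end

/-! ### Expected number of doubly connected sets -/

section
variable {V : Type*} {m : ℕ}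

/-- A rooted tree on `Fin (m + 1)` with root `0`, encoded by its parent map: along a rank function
`ρ` parents precede their children. The value at the root is arbitrary. -/
def IsParentMap (f : Fin (m + 1) → Fin (m + 1)) : Prop :=
  ∃ ρ : Fin (m + 1) → ℕ, ∀ i, i ≠ 0 → ρ (f i) < ρ i

/-- Under the labelling `v`, all tree edges `{i, f i}` are edges of `G`. -/
def Embeds (G : SimpleGraph V) (v : Fin (m + 1) → V) (f : Fin (m + 1) → Fin (m + 1)) : Prop :=
  ∀ i, i ≠ 0 → G.Adj (v i) (v (f i))

theorem exists_embeds_of_connected {G : SimpleGraph V} {S : Finset V} (v : Fin (m + 1) ↪ V)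
    (hv : Finset.univ.map v = S) (hG : (G.induce (S : Set V)).Connected) :
    ∃ f : Fin (m + 1) → Fin (m + 1), IsParentMap f ∧ Embeds G v f := by
  subst hv
  have hmem : ∀ i, v i ∈ ((Finset.univ.map v : Finset V) : Set V) := fun i => by simp
  let w : Fin (m + 1) → ((Finset.univ.map v : Finset V) : Set V) := fun i => ⟨v i, hmem i⟩
  have hw : ∀ u, ∃ i, w i = u := by
    rintro ⟨u, hu⟩
    simp only [Finset.coe_map, Finset.coe_univ, Set.image_univ, Set.mem_range] at hu
    obtain ⟨i, rfl⟩ := hu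
    exact ⟨i, rfl⟩
  choose w' hw' using hw
  obtain ⟨f, ρ, hf⟩ := exists_parent hG (w 0)
  have hne : ∀ i, i ≠ 0 → w i ≠ w 0 := fun i hi h => hi (v.injective (congrArg Subtype.val h))
  refine ⟨fun i => w' (f (w i)), ⟨fun i => ρ (w i), fun i hi => ?_⟩, fun i hi => ?_⟩
  · simp only [hw']
    exact (hf _ (hne i hi)).2
  · have h1 : G.Adj (w i) (f (w i)) := (hf _ (hne i hi)).1
    rw [← hw' (f (w i))] at h1
    exact h1

/-- Two vertices with the same parent edge would be each other's parents, against the rank. -/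
theorem IsParentMap.card_edges [DecidableEq V] {f : Fin (m + 1) → Fin (m + 1)} (hf : IsParentMap f)
    (v : Fin (m + 1) ↪ V) :
    ((Finset.univ.erase (0 : Fin (m + 1))).image fun i => s(v i, v (f i))).card = m := by
  obtain ⟨ρ, hρ⟩ := hf
  rw [Finset.card_image_of_injOn, Finset.card_erase_of_mem (Finset.mem_univ _), Finset.card_univ,
    Fintype.card_fin, Nat.add_sub_cancel]
  intro i hi j hj hij
  have hi0 := hρ i (Finset.ne_of_mem_erase hi)
  have hj0 := hρ j (Finset.ne_of_mem_erase hj)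
  rcases Sym2.eq_iff.1 hij with ⟨h, -⟩ | ⟨h1, h2⟩
  · exact v.injective h
  · rw [← v.injective h1] at hj0
    rw [v.injective h2] at hi0
    omega

theorem randomSubgraph_embeds_le [Finite V] (F : SimpleGraph V) (r : unitInterval)
    {f : Fin (m + 1) → Fin (m + 1)} (hf : IsParentMap f) (v : Fin (m + 1) ↪ V)
    [Decidable (Embeds F v f)] :
    (randomSubgraph F r).real {G | Embeds G v f} ≤ if Embeds F v f then (r : ℝ) ^ m else 0 := by
  classical
  split_ifs with h
  · have h1 := randomSubgraph_forall_mem F r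
      ((Finset.univ.erase (0 : Fin (m + 1))).image fun i => s(v i, v (f i))) (by
        intro e he
        simp only [Finset.coe_image, Set.mem_image, Finset.mem_coe] at he
        obtain ⟨i, hi, rfl⟩ := he
        exact h i (Finset.ne_of_mem_erase hi))
    rw [hf.card_edges] at h1
    rw [← h1]
    refine measureReal_mono (fun G hG => ?_) (measure_ne_top _ _)
    intro e he
    obtain ⟨i, hi, rfl⟩ := Finset.mem_image.1 he
    exact hG i (Finset.ne_of_mem_erase hi)
  · simp only [Embeds, not_forall] at h
    obtain ⟨i, hi, h⟩ := h
    rw [← randomSubgraph_mem_eq_zero F r (e := s(v i, v (f i))) h]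
    exact measureReal_mono (fun G hG => hG i hi) (measure_ne_top _ _)

/-- An embedding of a tree is determined by the image of the root and, for each other vertex, the
position of its image among the at most `d` neighbours of the image of its parent. -/
theorem card_embeds_le [Fintype V] [DecidableEq V] (F : SimpleGraph V) [DecidableRel F.Adj] {d : ℕ}
    (hd : 0 < d) (hF : ∀ u, F.degree u ≤ d) {f : Fin (m + 1) → Fin (m + 1)} (hf : IsParentMap f)
    [DecidablePred fun v : Fin (m + 1) → V => Embeds F v f] :
    (Finset.univ.filter fun v : Fin (m + 1) → V => Embeds F v f).card ≤ Fintype.card V * d ^ m := by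
  have hcode : ∀ u, ∃ c : V → Fin d, Set.InjOn c {w | F.Adj u w} := by
    intro u
    have : Fintype.card (F.neighborSet u) ≤ Fintype.card (Fin d) := by
      rw [SimpleGraph.card_neighborSet_eq_degree, Fintype.card_fin]
      exact hF u
    obtain ⟨e⟩ := Function.Embedding.nonempty_of_card_le this
    refine ⟨fun w => if h : F.Adj u w then e ⟨w, h⟩ else ⟨0, hd⟩, fun w hw w' hw' h => ?_⟩
    simp only [Set.mem_ofPred_eq] at hw hw'
    simp only [hw, hw', dif_pos] at h
    exact congrArg Subtype.val (e.injective h)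
  choose c hc using hcode
  have hcard : Fintype.card (V × ({i : Fin (m + 1) // i ≠ 0} → Fin d)) =
      Fintype.card V * d ^ m := by
    simp [Fintype.card_subtype_compl]
  rw [← hcard, ← Finset.card_univ]
  refine Finset.card_le_card_of_injOn (fun v => (v 0, fun i => c (v (f i)) (v i)))
    (fun _ _ => Finset.mem_coe.2 (Finset.mem_univ _)) ?_
  intro v hv v' hv' h
  simp only [Finset.coe_filter, Finset.mem_univ, true_and, Set.mem_ofPred_eq] at hv hv'
  obtain ⟨h0, h1⟩ := Prod.mk.inj h
  obtain ⟨ρ, hρ⟩ := hf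
  have key : ∀ k, ∀ i, ρ i = k → v i = v' i := by
    intro k
    induction k using Nat.strong_induction_on with
    | _ k ih =>
      intro i hik
      by_cases hi : i = 0
      · rw [hi, h0]
      · have hfi := ih (ρ (f i)) (hik ▸ hρ i hi) (f i) rfl
        have hci := congrFun h1 ⟨i, hi⟩
        simp only [hfi] at hci
        refine hc (v' (f i)) ?_ ((hv' i hi).symm) hci
        rw [← hfi]
        exact (hv i hi).symm
  exact funext fun i => key _ i rfl

theorem factorial_le_card_embeddings [Fintype V] [DecidableEq V] {S : Finset V}
    (hS : S.card = m + 1) :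
    (m + 1).factorial ≤
      (Finset.univ.filter fun v : Fin (m + 1) ↪ V => Finset.univ.map v = S).card := by
  let e : Fin (m + 1) ≃ S := (S.equivFinOfCardEq hS).symm
  have : (m + 1).factorial = (Finset.univ : Finset (Equiv.Perm (Fin (m + 1)))).card := by
    rw [Finset.card_univ, Fintype.card_perm, Fintype.card_fin]
  rw [this]
  refine Finset.card_le_card_of_injOn
    (fun σ => (σ.trans e).toEmbedding.trans (Function.Embedding.subtype _)) ?_ ?_
  · intro σ _
    simp only [Finset.coe_filter, Finset.mem_univ, true_and, Set.mem_ofPred_eq]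
    ext u
    simp only [Finset.mem_map, Finset.mem_univ, true_and]
    constructor
    · rintro ⟨i, rfl⟩
      exact (e (σ i)).2
    · intro hu
      exact ⟨σ.symm (e.symm ⟨u, hu⟩), by simp⟩
  · intro σ _ τ _ h
    ext i
    have := DFunLike.congr_fun h i
    have h2 : e (σ i) = e (τ i) := Subtype.ext this
    rw [e.injective h2]

/-- Union bound over the red trees, of which only those inside `F` count, and over all blue trees.
-/
theorem doublyConnected_prob_le [Finite V] (F : SimpleGraph V) (p q : unitInterval)
    {S : Finset V} (v : Fin (m + 1) ↪ V) (hv : Finset.univ.map v = S)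
    (D : Finset (Fin (m + 1) → Fin (m + 1))) (hD : ∀ f, f ∈ D ↔ IsParentMap f)
    [∀ f, Decidable (Embeds F v f)] :
    (doubleGraph F p q).real {H | DoublyConnected H.1 H.2 S} ≤
      (∑ f ∈ D, if Embeds F v f then 1 else 0) * ((m + 1 : ℝ) ^ (m + 1) * ((p : ℝ) * q) ^ m) := by
  have key : ∀ r : unitInterval, (randomSubgraph F r).real {G | (G.induce (S : Set V)).Connected} ≤
      ∑ f ∈ D, if Embeds F v f then (r : ℝ) ^ m else 0 := by
    intro r
    have hsub : {G : SimpleGraph V | (G.induce (S : Set V)).Connected} ⊆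
        ⋃ f ∈ D, {G | Embeds G v f} := by
      intro G hG
      obtain ⟨f, hf, hf'⟩ := exists_embeds_of_connected v hv hG
      simp only [Set.mem_iUnion, exists_prop]
      exact ⟨f, (hD f).2 hf, hf'⟩
    refine (measureReal_mono hsub (measure_ne_top _ _)).trans
      ((measureReal_biUnion_finset_le _ _).trans ?_)
    exact Finset.sum_le_sum fun f hf => randomSubgraph_embeds_le F r ((hD f).1 hf) v
  have hq : (randomSubgraph F q).real {G | (G.induce (S : Set V)).Connected} ≤
      (m + 1 : ℝ) ^ (m + 1) * (q : ℝ) ^ m := by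
    refine (key q).trans ((Finset.sum_le_card_nsmul D _ ((q : ℝ) ^ m) fun f _ => ?_).trans ?_)
    · split_ifs
      · exact le_rfl
      · exact pow_nonneg q.2.1 _
    · rw [nsmul_eq_mul]
      refine mul_le_mul_of_nonneg_right ?_ (pow_nonneg q.2.1 _)
      have := Finset.card_le_univ D
      simp only [Fintype.card_fun, Fintype.card_fin] at this
      exact_mod_cast this
  have hp : (randomSubgraph F p).real {G | (G.induce (S : Set V)).Connected} ≤
      (∑ f ∈ D, if Embeds F v f then 1 else 0) * (p : ℝ) ^ m := by
    refine (key p).trans (le_of_eq ?_)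
    rw [Finset.sum_mul]
    simp
  have := doubleGraph_and F p q (fun G => (G.induce (S : Set V)).Connected)
    (fun G => (G.induce (S : Set V)).Connected)
  refine (le_of_eq this).trans ((mul_le_mul hp hq measureReal_nonneg ?_).trans (le_of_eq ?_))
  · exact mul_nonneg (Finset.sum_nonneg fun _ _ => by split_ifs <;> norm_num) (pow_nonneg p.2.1 _)
  · rw [mul_pow]; ring

/-- First moment bound for doubly connected sets: every set is counted `(m + 1)!` times when summing
over labelled sets. -/
theorem exists_doublyConnected_prob_le [Fintype V] (F : SimpleGraph V) [DecidableRel F.Adj]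
    {d : ℕ} (hd : 0 < d) (hF : ∀ u, F.degree u ≤ d) (p q : unitInterval) (m : ℕ) :
    (doubleGraph F p q).real {H | ∃ S : Finset V, S.card = m + 1 ∧ DoublyConnected H.1 H.2 S} ≤
      Real.exp (m + 1) * (m + 1) ^ (m + 1) * Fintype.card V * (d * ((p : ℝ) * q)) ^ m := by
  classical
  set μ := doubleGraph F p q
  let D : Finset (Fin (m + 1) → Fin (m + 1)) := {f | IsParentMap f}
  have hD : ∀ f, f ∈ D ↔ IsParentMap f := fun f => by simp [D]
  have hfac : (0 : ℝ) < (m + 1).factorial := by exact_mod_cast (m + 1).factorial_pos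
  set g : ℝ := (m + 1 : ℝ) ^ (m + 1) * ((p : ℝ) * q) ^ m with hg
  have hg0 : 0 ≤ g := mul_nonneg (by positivity) (pow_nonneg (mul_nonneg p.2.1 q.2.1) _)
  set P : Finset V → ℝ := fun S => μ.real {H | DoublyConnected H.1 H.2 S}
  have hsub : {H : SimpleGraph V × SimpleGraph V | ∃ S : Finset V, S.card = m + 1 ∧
      DoublyConnected H.1 H.2 S} ⊆ ⋃ S ∈ (Finset.univ : Finset V).powersetCard (m + 1),
      {H | DoublyConnected H.1 H.2 S} := by
    rintro H ⟨S, hS, hc⟩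
    simp only [Set.mem_iUnion, exists_prop, Finset.mem_powersetCard]
    exact ⟨S, ⟨Finset.subset_univ _, hS⟩, hc⟩
  have h1 : μ.real {H | ∃ S : Finset V, S.card = m + 1 ∧ DoublyConnected H.1 H.2 S} ≤
      ∑ S ∈ Finset.univ.powersetCard (m + 1), P S :=
    (measureReal_mono hsub (measure_ne_top _ _)).trans (measureReal_biUnion_finset_le _ _)
  have h2 : (m + 1).factorial * ∑ S ∈ Finset.univ.powersetCard (m + 1), P S ≤
      ∑ v : Fin (m + 1) ↪ V, P (Finset.univ.map v) := by
    rw [← Finset.sum_fiberwise_of_maps_to (s := Finset.univ)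
      (t := (Finset.univ : Finset V).powersetCard (m + 1))
      (g := fun v : Fin (m + 1) ↪ V => Finset.univ.map v)
      (fun v _ => Finset.mem_powersetCard.2 ⟨Finset.subset_univ _, by simp⟩), Finset.mul_sum]
    refine Finset.sum_le_sum fun S hS => ?_
    have hle := factorial_le_card_embeddings (Finset.mem_powersetCard.1 hS).2
    rw [Finset.sum_congr rfl fun v hv => by rw [(Finset.mem_filter.1 hv).2], Finset.sum_const,
      nsmul_eq_mul]
    exact mul_le_mul_of_nonneg_right (by exact_mod_cast hle) measureReal_nonneg
  have h3 : ∑ v : Fin (m + 1) ↪ V, P (Finset.univ.map v) ≤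
      ((m + 1 : ℝ) ^ (m + 1) * (Fintype.card V * d ^ m)) * g := by
    refine (Finset.sum_le_sum fun v _ => doublyConnected_prob_le F p q v rfl D hD).trans ?_
    rw [← Finset.sum_mul]
    refine mul_le_mul_of_nonneg_right ?_ hg0
    rw [Finset.sum_comm]
    refine (Finset.sum_le_card_nsmul D _ (Fintype.card V * d ^ m : ℝ) fun f hf => ?_).trans ?_
    · rw [Finset.sum_boole]
      have hle := card_embeds_le F hd hF ((hD f).1 hf)
      have hle2 : (Finset.univ.filter fun v : Fin (m + 1) ↪ V => Embeds F v f).card ≤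
          (Finset.univ.filter fun v : Fin (m + 1) → V => Embeds F v f).card :=
        Finset.card_le_card_of_injOn (fun v => v) (fun v hv => by simpa using hv)
          (fun v _ w _ h => DFunLike.coe_injective h)
      exact_mod_cast hle2.trans hle
    · rw [nsmul_eq_mul]
      refine mul_le_mul_of_nonneg_right ?_ (by positivity)
      have := Finset.card_le_univ D
      simp only [Fintype.card_fun, Fintype.card_fin] at this
      exact_mod_cast this
  have h4 : (m + 1 : ℝ) ^ (m + 1) / (m + 1).factorial ≤ Real.exp (m + 1) :=
    Real.pow_div_factorial_le_exp _ (by positivity) _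
  rw [div_le_iff₀ hfac] at h4
  refine h1.trans (le_of_mul_le_mul_left ((h2.trans h3).trans ?_) hfac)
  calc ((m + 1 : ℝ) ^ (m + 1) * (Fintype.card V * d ^ m)) * g
      ≤ (Real.exp (m + 1) * (m + 1).factorial * (Fintype.card V * d ^ m)) * g := by gcongr
    _ = _ := by rw [hg, mul_pow]; ring

theorem degree_intersectingPairs_le (n : ℕ) [DecidableRel (intersectingPairs n).Adj]
    (u : TwoSets n) : (intersectingPairs n).degree u ≤ 2 * n := by
  classical
  rw [← SimpleGraph.card_neighborFinset_eq_degree]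
  have hsub : ((intersectingPairs n).neighborFinset u).map (Function.Embedding.subtype _) ⊆
      (u.1 ×ˢ (Finset.univ : Finset (Fin n))).image fun a => {a.1, a.2} := by
    intro e he
    simp only [Finset.mem_map, SimpleGraph.mem_neighborFinset] at he
    obtain ⟨w, ⟨-, x, hx⟩, rfl⟩ := he
    rw [Finset.mem_inter] at hx
    obtain ⟨y, h, rfl⟩ := exists_eq_pairOf (mem_star.2 hx.2)
    exact Finset.mem_image.2 ⟨(x, y), by simp [hx.1], rfl⟩
  have := (Finset.card_le_card hsub).trans Finset.card_image_le
  rwa [Finset.card_map, Finset.card_product, u.2, Finset.card_univ, Fintype.card_fin] at this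

end

/-! ### The subcritical regime -/

section

theorem tendsto_log_sq_div_sq :
    Tendsto (fun n : ℕ => 1000 * (Real.log n / n) ^ 2) atTop (𝓝 0) := by
  have h : Tendsto (fun n : ℕ => Real.log n / n) atTop (𝓝 0) :=
    Real.isLittleO_log_id_atTop.tendsto_div_nhds_zero.comp tendsto_natCast_atTop_atTop
  simpa using (h.pow 2).const_mul 1000

theorem exp_five_lt : Real.exp 5 < 149 := by
  have h : Real.exp 5 = Real.exp 1 ^ 5 := by rw [← Real.exp_nat_mul]; norm_num
  rw [h]
  calc Real.exp 1 ^ 5 < 2.7182818286 ^ 5 :=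
        pow_lt_pow_left₀ Real.exp_one_lt_d9 (Real.exp_pos _).le (by norm_num)
    _ < 149 := by norm_num

theorem doublyConnected_prob_le_of_subcritical {n : ℕ} {p q : unitInterval}
    (hℓ : 1 ≤ Real.log n) (hpq : (p : ℝ) * q ≤ 1 / (10000 * n * Real.log n)) {m : ℕ}
    (hm : Real.log n - 1 ≤ m) (hm' : (m : ℝ) + 1 ≤ 3 * Real.log n) :
    (doubleGraph (intersectingPairs n) p q).real
      {H | ∃ S : Finset (TwoSets n), S.card = m + 1 ∧ DoublyConnected H.1 H.2 S} ≤
      447 * Real.log n / (n : ℝ) ^ 2 := by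
  classical
  set ℓ := Real.log n with hℓdef
  have hn0 : 0 < n := by
    rcases Nat.eq_zero_or_pos n with rfl | h
    · simp [hℓdef] at hℓ; linarith
    · exact h
  have hn : (0 : ℝ) < n := by exact_mod_cast hn0
  have hexpℓ : Real.exp ℓ = n := Real.exp_log hn
  refine (exists_doublyConnected_prob_le (intersectingPairs n) (by omega : 0 < 2 * n)
    (degree_intersectingPairs_le n) p q m).trans ?_
  have hN : (Fintype.card (TwoSets n) : ℝ) ≤ (n : ℝ) ^ 2 := by
    have : Fintype.card (TwoSets n) ≤ n ^ 2 := by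
      rw [Fintype.card_finset_len, Fintype.card_fin]
      exact Nat.choose_le_pow n 2
    exact_mod_cast this
  have hpq0 : 0 ≤ (p : ℝ) * q := mul_nonneg p.2.1 q.2.1
  have hbase : Real.exp 1 * (m + 1) * (2 * n * ((p : ℝ) * q)) ≤ Real.exp (-4) := by
    have h1 : Real.exp (-4) = Real.exp 1 / Real.exp 5 := by rw [← Real.exp_sub]; norm_num
    calc Real.exp 1 * (m + 1) * (2 * n * ((p : ℝ) * q))
        ≤ Real.exp 1 * (3 * ℓ) * (2 * n * (1 / (10000 * n * ℓ))) := by gcongr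
      _ = Real.exp 1 * (6 / 10000) := by field_simp; norm_num
      _ ≤ Real.exp 1 * (1 / Real.exp 5) := by
          refine mul_le_mul_of_nonneg_left ?_ (Real.exp_pos _).le
          rw [div_le_div_iff₀ (by norm_num) (Real.exp_pos _)]
          linarith [exp_five_lt]
      _ = Real.exp (-4) := by rw [h1]; ring
  have hpow : (Real.exp 1 * (m + 1) * (2 * n * ((p : ℝ) * q))) ^ m ≤ Real.exp 4 / n ^ 4 := by
    calc _ ≤ Real.exp (-4) ^ m := by gcongr
      _ = Real.exp (m * (-4)) := by rw [Real.exp_nat_mul]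
      _ ≤ Real.exp (4 - 4 * ℓ) := by gcongr; linarith
      _ = Real.exp 4 / n ^ 4 := by
          rw [Real.exp_sub, ← hexpℓ, ← Real.exp_nat_mul]; norm_num
  have hexpm : Real.exp (m + 1) = Real.exp 1 ^ (m + 1) := by
    rw [← Real.exp_nat_mul]; norm_num
  calc Real.exp (m + 1) * (m + 1) ^ (m + 1) * Fintype.card (TwoSets n) *
        (((2 * n : ℕ) : ℝ) * ((p : ℝ) * q)) ^ m
      = Real.exp 1 * (m + 1) * Fintype.card (TwoSets n) *
        (Real.exp 1 * (m + 1) * (2 * n * ((p : ℝ) * q))) ^ m := by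
          rw [hexpm]; push_cast; simp only [mul_pow, pow_succ]; ring
    _ ≤ Real.exp 1 * (3 * ℓ) * (n : ℝ) ^ 2 * (Real.exp 4 / n ^ 4) := by gcongr
    _ = (Real.exp 5) * (3 * ℓ) / n ^ 2 := by
          have : Real.exp 5 = Real.exp 1 * Real.exp 4 := by rw [← Real.exp_add]; norm_num
          rw [this]; field_simp
    _ ≤ 447 * ℓ / (n : ℝ) ^ 2 := by
          gcongr ?_ / _
          nlinarith [exp_five_lt]

theorem percolates_prob_le_of_subcritical {n : ℕ} {p q : unitInterval}
    (hℓ : 1 ≤ Real.log n) (hn3 : 3 ≤ n) (hpq : (p : ℝ) * q ≤ 1 / (10000 * n * Real.log n)) :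
    (doubleGraph (intersectingPairs n) p q).real {H | JigsawPercolates H.1 H.2} ≤
      1000 * (Real.log n / n) ^ 2 := by
  classical
  set ℓ := Real.log n with hℓdef
  have hn : (0 : ℝ) < n := by positivity
  set k := ⌈ℓ⌉₊ with hk
  have hk1 : 1 ≤ k := Nat.one_le_ceil_iff.2 (by linarith)
  have hkle : ℓ ≤ k := Nat.le_ceil ℓ
  have hklt : (k : ℝ) < ℓ + 1 := Nat.ceil_lt_add_one (by linarith)
  have hkN : k ≤ Fintype.card (TwoSets n) := by
    have h1 : k ≤ n := by
      rw [hk, Nat.ceil_le]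
      linarith [Real.log_le_sub_one_of_pos hn]
    rw [Fintype.card_finset_len, Fintype.card_fin]
    refine h1.trans ?_
    rw [Nat.choose_two_right, Nat.le_div_iff_mul_le (by norm_num)]
    exact Nat.mul_le_mul_left n (by omega)
  have hsub : {H : SimpleGraph (TwoSets n) × SimpleGraph (TwoSets n) | JigsawPercolates H.1 H.2} ⊆
      ⋃ m ∈ Finset.Ico (k - 1) (2 * k - 1),
        {H | ∃ S : Finset (TwoSets n), S.card = m + 1 ∧ DoublyConnected H.1 H.2 S} := by
    intro H hH
    obtain ⟨S, h1, h2, h3⟩ := JigsawPercolates.exists_doublyConnected hH hk1 hkN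
    simp only [Set.mem_iUnion, exists_prop, Finset.mem_Ico]
    exact ⟨S.card - 1, by omega, S, by omega, h3⟩
  refine (measureReal_mono hsub (measure_ne_top _ _)).trans
    ((measureReal_biUnion_finset_le _ _).trans ?_)
  refine (Finset.sum_le_card_nsmul _ _ (447 * ℓ / (n : ℝ) ^ 2) fun m hm => ?_).trans ?_
  · rw [Finset.mem_Ico] at hm
    refine doublyConnected_prob_le_of_subcritical hℓ hpq ?_ ?_
    · have : (k : ℝ) ≤ m + 1 := by exact_mod_cast (by omega : k ≤ m + 1)
      linarith
    · have : (m : ℝ) + 2 ≤ 2 * k := by exact_mod_cast (by omega : m + 2 ≤ 2 * k)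
      linarith
  · rw [Nat.card_Ico, nsmul_eq_mul, show 2 * k - 1 - (k - 1) = k by omega]
    calc (k : ℝ) * (447 * ℓ / (n : ℝ) ^ 2) ≤ (2 * ℓ) * (447 * ℓ / (n : ℝ) ^ 2) := by
          gcongr; linarith
      _ = 894 * (ℓ / n) ^ 2 := by ring
      _ ≤ 1000 * (ℓ / n) ^ 2 := by gcongr; norm_num

end

/-! ### The supercritical regime -/

section

theorem div_one_add_le_one_sub_exp_neg {y : ℝ} (hy : 0 ≤ y) : y / (1 + y) ≤ 1 - Real.exp (-y) := by
  have h1 : 1 + y ≤ Real.exp y := by linarith [Real.add_one_le_exp y]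
  have h2 : Real.exp (-y) ≤ 1 / (1 + y) := by
    rw [Real.exp_neg, ← one_div]
    exact one_div_le_one_div_of_le (by linarith) h1
  have h3 : y / (1 + y) = 1 - 1 / (1 + y) := by field_simp; ring
  linarith

theorem one_sub_pow_le_exp {x : ℝ} (hx : x ≤ 1) (k : ℕ) : (1 - x) ^ k ≤ Real.exp (-(k * x)) := by
  calc (1 - x) ^ k ≤ Real.exp (-x) ^ k :=
        pow_le_pow_left₀ (by linarith) (Real.one_sub_le_exp_neg x) k
    _ = Real.exp (-(k * x)) := by rw [← Real.exp_nat_mul]; ring_nf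

/-- With `α = k * p` and `β = k * q`, the attachment probability is at least
`α / (1 + α) * (β / (1 + β))`, which is of the order of the minimum of `α * β`, `α`, `β` and `1`. -/
theorem le_attachProb {p q : unitInterval} {k : ℕ} {t : ℝ} (ht : 0 < t)
    (h₁ : 4 * t ≤ k ^ 2 * (p * q)) (h₂ : 4 * t ≤ k * p) (h₃ : 4 * t ≤ k * q) (h₄ : 4 * t ≤ 1) :
    t ≤ attachProb p q k := by
  have key : ∀ r : unitInterval, 4 * t ≤ k * r → (k * r : ℝ) / (1 + k * r) ≤ 1 - (1 - r) ^ k := by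
    intro r hr
    have := div_one_add_le_one_sub_exp_neg (y := (k * r : ℝ)) (by linarith)
    have h2 := one_sub_pow_le_exp r.2.2 k
    linarith
  have hα : 0 < (k * p : ℝ) := by linarith
  have hβ : 0 < (k * q : ℝ) := by linarith
  refine le_trans ?_ (mul_le_mul (key p h₂) (key q h₃) (by positivity) ?_)
  · rw [div_mul_div_comm, le_div_iff₀ (by positivity)]
    have h₁' : 4 * t ≤ (k * p) * (k * q : ℝ) := by nlinarith
    have e1 := mul_le_mul_of_nonneg_left h₃ hα.le
    have e2 := mul_le_mul_of_nonneg_left h₂ hβ.le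
    have e3 := mul_le_mul_of_nonneg_left h₄ (mul_nonneg hα.le hβ.le)
    nlinarith
  · exact le_trans (by positivity) (key p h₂)

theorem one_sub_pow_one_sub_ge {s t : ℝ} {N : ℕ} (hs : s ≤ 1) (ht : t ≤ N * s) :
    1 - Real.exp (-t) ≤ 1 - (1 - s) ^ N := by
  have := one_sub_pow_le_exp hs N
  have : Real.exp (-(N * s)) ≤ Real.exp (-t) := Real.exp_le_exp.2 (by linarith)
  linarith

theorem half_le_natFloor {x : ℝ} (hx : 1 ≤ x) : x / 2 ≤ ⌊x⌋₊ := by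
  have h1 : (1 : ℝ) ≤ ⌊x⌋₊ := by exact_mod_cast Nat.le_floor (by simpa using hx)
  have h2 := Nat.lt_floor_add_one x
  linarith

theorem exp_neg_two_mul_le {x : ℝ} (h0 : 0 ≤ x) (h1 : x ≤ 1 / 2) : Real.exp (-(2 * x)) ≤ 1 - x := by
  have h := Real.add_one_le_exp (2 * x)
  rw [Real.exp_neg, inv_le_comm₀ (Real.exp_pos _) (by linarith)]
  refine le_trans ?_ h
  rw [inv_le_iff_one_le_mul₀ (by linarith)]
  nlinarith

theorem inv_mul_sqrt_le {k : ℕ} (hk : 1 ≤ k) :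
    1 / (((k + 1 : ℕ) : ℝ) * √((k + 1 : ℕ) : ℝ)) ≤ 2 * (1 / √(k : ℝ) - 1 / √((k + 1 : ℕ) : ℝ)) := by
  have hk' : (1 : ℝ) ≤ k := by exact_mod_cast hk
  push_cast
  set a := √(k : ℝ) with ha
  set b := √((k : ℝ) + 1) with hb
  have ha0 : 0 < a := Real.sqrt_pos.2 (by linarith)
  have hb0 : 0 < b := Real.sqrt_pos.2 (by linarith)
  have ha2 : a ^ 2 = k := Real.sq_sqrt (by linarith)
  have hb2 : b ^ 2 = k + 1 := Real.sq_sqrt (by linarith)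
  have hab : a ≤ b := Real.sqrt_le_sqrt (by linarith)
  have hdiff : (b - a) * (b + a) = 1 := by nlinarith
  rw [← hb2, div_sub_div _ _ ha0.ne' hb0.ne', ← mul_div_assoc,
    div_le_div_iff₀ (by positivity) (by positivity)]
  have h1 : 1 ≤ (b - a) * (2 * b) := by nlinarith
  have h2 : a * b ≤ b ^ 2 := by nlinarith
  nlinarith [mul_pos hb0 hb0, mul_le_mul_of_nonneg_right h1 (by positivity : 0 ≤ b ^ 2)]

/-- The number of vertices inspected in the step from size `i + 1` to size `i + 2`. A constant size
suffices for the first `m` steps; afterwards the sizes decay like `k ^ (-3/2)`, `k = i + 1`, which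
is summable, while the failure probabilities, with exponent of order `(k / m) ^ (1/2)`, are summable
too. -/
noncomputable def blockSize (n m i : ℕ) : ℕ :=
  if i < m then ⌊(n : ℝ) / (4 * m)⌋₊
  else ⌊(n : ℝ) * √m / (16 * (((i + 1 : ℕ) : ℝ) * √((i + 1 : ℕ) : ℝ)))⌋₊

theorem sum_blockSize_le (n : ℕ) {m : ℕ} (hm : 1 ≤ m) (r : ℕ) :
    (∑ i ∈ Finset.range r, blockSize n m i : ℝ) ≤ 3 / 8 * n := by
  have hm' : (1 : ℝ) ≤ m := by exact_mod_cast hm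
  have hn : (0 : ℝ) ≤ n := Nat.cast_nonneg n
  have h1 : ∀ r ≤ m, (∑ i ∈ Finset.range r, blockSize n m i : ℝ) ≤ r * (n / (4 * m)) := by
    intro r hr
    refine (Finset.sum_le_card_nsmul _ _ ((n : ℝ) / (4 * m)) fun i hi => ?_).trans (by simp)
    rw [blockSize, if_pos (by simp at hi; omega)]
    exact Nat.floor_le (by positivity)
  have h2 : ∀ r, m ≤ r → (∑ i ∈ Finset.range r, blockSize n m i : ℝ) ≤
      n / 4 + n * √m / 8 * (1 / √m - 1 / √(r : ℝ)) := by
    intro r hr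
    induction r, hr using Nat.le_induction with
    | base =>
      refine (h1 m le_rfl).trans (le_of_eq ?_)
      field_simp; ring
    | succ r hr ih =>
      rw [Finset.sum_range_succ]
      have h3 : (blockSize n m r : ℝ) ≤
          n * √m / 16 * (1 / (((r + 1 : ℕ) : ℝ) * √((r + 1 : ℕ) : ℝ))) := by
        rw [blockSize, if_neg (by omega)]
        refine (Nat.floor_le (by positivity)).trans (le_of_eq ?_)
        field_simp
      have h4 := mul_le_mul_of_nonneg_left (inv_mul_sqrt_le (hm.trans hr))
        (by positivity : 0 ≤ n * √m / 16)
      calc _ ≤ _ := add_le_add ih (h3.trans h4)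
        _ = _ := by ring
  rcases le_total r m with hr | hr
  · refine (h1 r hr).trans ?_
    have : (r : ℝ) ≤ m := by exact_mod_cast hr
    calc (r : ℝ) * (n / (4 * m)) ≤ m * (n / (4 * m)) := by gcongr
      _ = n / 4 := by field_simp
      _ ≤ 3 / 8 * n := by linarith
  · refine (h2 r hr).trans ?_
    have hs : 0 < √(m : ℝ) := Real.sqrt_pos.2 (by linarith)
    calc (n : ℝ) / 4 + n * √m / 8 * (1 / √m - 1 / √(r : ℝ)) ≤
          n / 4 + n * √m / 8 * (1 / √m) := by
          gcongr
          have : (0 : ℝ) ≤ 1 / √(r : ℝ) := by positivity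
          linarith
      _ = 3 / 8 * n := by field_simp; ring

/-- The hypotheses of the supercritical case with constant `10000`, and `n` large. -/
structure Supercritical (n : ℕ) (p q : unitInterval) : Prop where
  log_ge : 100 ≤ Real.log n
  log_le : 10000 * Real.log n ^ 4 ≤ √n
  prod_ge : 10000 / (n * Real.log n) ≤ (p : ℝ) * q
  fst_ge : 10000 * Real.log n / n ≤ (p : ℝ)
  snd_ge : 10000 * Real.log n / n ≤ (q : ℝ)

namespace Supercritical
variable {n : ℕ} {p q : unitInterval} (h : Supercritical n p q)
include h

theorem one_le_sqrt : 1 ≤ √(n : ℝ) := by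
  have := pow_le_pow_left₀ (by norm_num) h.log_ge 4
  linarith [h.log_le]

theorem sqrt_le : √(n : ℝ) ≤ n := by
  have h1 := h.one_le_sqrt
  have h2 := Real.sq_sqrt (Nat.cast_nonneg (α := ℝ) n)
  nlinarith

theorem pos : (0 : ℝ) < n := by linarith [h.one_le_sqrt, h.sqrt_le]

theorem log_pow_le : 10000 * Real.log n ^ 4 ≤ n := h.log_le.trans h.sqrt_le

theorem exp_log : Real.exp (Real.log n) = n := Real.exp_log h.pos

theorem scale_bounds {m : ℕ} (hm : m = ⌈Real.log n / 10⌉₊) :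
    Real.log n ≤ 10 * m ∧ 4 * (m : ℝ) ≤ Real.log n / 2 ∧ 1 ≤ m := by
  have h1 := Nat.le_ceil (Real.log n / 10)
  have h2 := Nat.ceil_lt_add_one (a := Real.log n / 10) (by linarith [h.log_ge])
  rw [← hm] at h1 h2
  refine ⟨by linarith, by linarith [h.log_ge], ?_⟩
  have : (0 : ℝ) < m := by linarith [h.log_ge]
  exact_mod_cast this

theorem attachProb_ge {k : ℕ} (hk : 1 ≤ k) (hk' : (k : ℝ) ≤ Real.log n ^ 2) :
    2500 * k ^ 2 / (n * Real.log n) ≤ attachProb p q k := by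
  have hn := h.pos
  have hℓ : 0 < Real.log n := by linarith [h.log_ge]
  have hk1 : (1 : ℝ) ≤ k := by exact_mod_cast hk
  set ℓ := Real.log n
  have hside : 4 * (2500 * k ^ 2 / (n * ℓ)) ≤ k * (10000 * ℓ / n) := by
    have : k * (10000 * ℓ / n) = 10000 * (k * ℓ ^ 2) / (n * ℓ) := by field_simp
    rw [this, ← mul_div_assoc]
    gcongr ?_ / _
    nlinarith
  refine le_attachProb (by positivity) ?_ ?_ ?_ ?_
  · calc 4 * (2500 * k ^ 2 / (n * ℓ)) = k ^ 2 * (10000 / (n * ℓ)) := by ring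
      _ ≤ (k : ℝ) ^ 2 * ((p : ℝ) * q) := by gcongr; exact h.prod_ge
  · exact hside.trans (by gcongr; exact h.fst_ge)
  · exact hside.trans (by gcongr; exact h.snd_ge)
  · rw [← mul_div_assoc, div_le_one (by positivity)]
    have h1 : (k : ℝ) ^ 2 ≤ (ℓ ^ 2) ^ 2 := by gcongr
    have h2 := h.log_pow_le
    have h3 : (n : ℝ) * 1 ≤ n * ℓ := by gcongr; linarith [h.log_ge]
    nlinarith

/-- For `k = i + 1 ≤ m`, at least `(k / m) ^ 2` attached vertices are expected in the block. -/
theorem factor_ge_of_lt {m : ℕ} (hm : m = ⌈Real.log n / 10⌉₊) {i : ℕ} (hi : i < m) :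
    ((i + 1 : ℕ) : ℝ) ^ 2 / (2 * m ^ 2) ≤
      1 - (1 - attachProb p q (i + 1)) ^ blockSize n m i := by
  obtain ⟨hm1, hm2, hm3⟩ := h.scale_bounds hm
  have hn := h.pos
  have hℓ := h.log_ge
  have hlp := h.log_pow_le
  set ℓ := Real.log n
  have hmpos : (1 : ℝ) ≤ m := by exact_mod_cast hm3
  set k := i + 1
  have hk1 : (1 : ℝ) ≤ k := by exact_mod_cast (by omega : 1 ≤ k)
  have hkm : (k : ℝ) ≤ m := by exact_mod_cast hi
  have hℓn : ℓ ≤ ℓ ^ 4 := le_self_pow₀ (by linarith) (by norm_num)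
  have hN : (n : ℝ) / (8 * m) ≤ blockSize n m i := by
    rw [blockSize, if_pos hi]
    refine le_trans (le_of_eq ?_) (half_le_natFloor ?_)
    · field_simp; norm_num
    · rw [le_div_iff₀ (by positivity)]
      nlinarith
  set y : ℝ := (k : ℝ) ^ 2 / m ^ 2 with hy
  have hy1 : y ≤ 1 := by rw [hy, div_le_one (by positivity)]; gcongr
  have hy0 : 0 ≤ y := by positivity
  have hq := h.attachProb_ge (k := k) (by omega) (by nlinarith)
  have ht : y ≤ blockSize n m i * attachProb p q k := by
    refine le_trans ?_ (mul_le_mul hN hq (by positivity) (by positivity))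
    have : (n : ℝ) / (8 * m) * (2500 * k ^ 2 / (n * ℓ)) = k ^ 2 * (312.5 / (m * ℓ)) := by
      field_simp; norm_num
    rw [this, hy, div_eq_mul_one_div]
    refine mul_le_mul_of_nonneg_left ?_ (by positivity)
    rw [div_le_div_iff₀ (by positivity) (by positivity)]
    nlinarith
  refine le_trans ?_ (one_sub_pow_one_sub_ge (attachProb_le_one p q k) ht)
  refine le_trans ?_ (div_one_add_le_one_sub_exp_neg hy0)
  calc (k : ℝ) ^ 2 / (2 * m ^ 2) = y / 2 := by rw [hy]; field_simp
    _ ≤ y / (1 + y) := by gcongr; linarith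

/-- Lower bound for the success probability of a step beyond size `m`, in a form that telescopes in
the product. -/
theorem factor_ge_of_ge {m : ℕ} (hm : m = ⌈Real.log n / 10⌉₊) {i : ℕ} (hi : m ≤ i)
    (hi' : i + 1 ≤ m ^ 2) :
    Real.exp (-((m : ℝ) ^ 2 * (1 / i - 1 / ((i + 1 : ℕ) : ℝ)))) ≤
      1 - (1 - attachProb p q (i + 1)) ^ blockSize n m i := by
  obtain ⟨hm1, hm2, hm3⟩ := h.scale_bounds hm
  have hn := h.pos
  have hℓ := h.log_ge
  have hlp := h.log_pow_le
  set ℓ := Real.log n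
  have hmpos : (1 : ℝ) ≤ m := by exact_mod_cast hm3
  have hi1 : (1 : ℝ) ≤ i := by exact_mod_cast hm3.trans hi
  have hki : ((i + 1 : ℕ) : ℝ) = i + 1 := by push_cast; ring
  set k := i + 1 with hk
  have hk1 : (1 : ℝ) ≤ k := by linarith
  have hmk : (m : ℝ) ≤ k := by exact_mod_cast (by omega : m ≤ k)
  have hkm : (k : ℝ) ≤ m ^ 2 := by exact_mod_cast hi'
  have hkℓ : (k : ℝ) ≤ ℓ ^ 2 := by nlinarith
  have hsm : √(m : ℝ) ^ 2 = m := Real.sq_sqrt (by linarith)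
  have hsk : √(k : ℝ) ^ 2 = k := Real.sq_sqrt (by linarith)
  have hsm1 : 1 ≤ √(m : ℝ) := Real.one_le_sqrt.2 hmpos
  have hsk1 : 1 ≤ √(k : ℝ) := Real.one_le_sqrt.2 hk1
  have hskk : √(k : ℝ) ≤ k := by nlinarith
  have hN : (n : ℝ) * √m / (32 * (k * √k)) ≤ blockSize n m i := by
    rw [blockSize, if_neg (by omega)]
    refine le_trans (le_of_eq ?_) (half_le_natFloor ?_)
    · rw [div_div]; congr 1; ring
    · rw [le_div_iff₀ (by positivity)]
      have h1 : (k : ℝ) * √k ≤ ℓ ^ 2 * ℓ ^ 2 := by gcongr; exact hskk.trans hkℓ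
      nlinarith
  have hq := h.attachProb_ge (k := k) (by omega) hkℓ
  set t : ℝ := 78 * (√m * √k) / ℓ with ht
  have htle : t ≤ blockSize n m i * attachProb p q k := by
    refine le_trans ?_ (mul_le_mul hN hq (by positivity) (by positivity))
    have : (n : ℝ) * √m / (32 * (k * √k)) * (2500 * k ^ 2 / (n * ℓ)) =
        78.125 * (√m * √k) / ℓ := by
      have h1 : (k : ℝ) = √k * √k := by nlinarith
      rw [div_mul_div_comm, div_eq_div_iff (by positivity) (by positivity)]
      have h2 : (k : ℝ) ^ 2 = k * (√k * √k) := by rw [← h1]; ring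
      rw [h2]; ring
    rw [this, ht]
    gcongr
    norm_num
  refine le_trans ?_ (one_sub_pow_one_sub_ge (attachProb_le_one p q k) htle)
  -- the fourth power of `t` is of order `(k / m) ^ 2`, hence the failure probability is summable
  have ht0 : 0 < t := by positivity
  have ht4 : 2400 * (k : ℝ) ^ 2 / m ^ 2 ≤ t ^ 4 := by
    have : t ^ 4 = 78 ^ 4 * (m ^ 2 * k ^ 2) / ℓ ^ 4 := by
      rw [ht, div_pow, mul_pow, mul_pow, show √(m : ℝ) ^ 4 = (√(m : ℝ) ^ 2) ^ 2 by ring,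
        show √(k : ℝ) ^ 4 = (√(k : ℝ) ^ 2) ^ 2 by ring, hsm, hsk]
    rw [this, div_le_div_iff₀ (by positivity) (by positivity)]
    have h1 : ℓ ^ 4 ≤ (10 * m) ^ 4 := by gcongr
    calc 2400 * (k : ℝ) ^ 2 * ℓ ^ 4 ≤ 2400 * (k : ℝ) ^ 2 * (10 * m) ^ 4 := by gcongr
      _ = 24000000 * ((k : ℝ) ^ 2 * m ^ 4) := by ring
      _ ≤ 78 ^ 4 * ((k : ℝ) ^ 2 * m ^ 4) := by gcongr; norm_num
      _ = _ := by ring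
  set x : ℝ := (m : ℝ) ^ 2 / (100 * k ^ 2) with hx
  have hexp : Real.exp (-t) ≤ x := by
    have h1 := Real.pow_div_factorial_le_exp t ht0.le 4
    have h2 : 100 * (k : ℝ) ^ 2 / m ^ 2 ≤ Real.exp t := by
      refine le_trans ?_ h1
      rw [show ((Nat.factorial 4 : ℕ) : ℝ) = 24 by norm_num [Nat.factorial],
        le_div_iff₀ (by norm_num)]
      refine le_trans (le_of_eq ?_) ht4
      ring
    rw [Real.exp_neg, hx, inv_le_comm₀ (Real.exp_pos _) (by positivity), inv_div]
    exact h2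
  have hx2 : x ≤ 1 / 2 := by
    rw [hx, div_le_div_iff₀ (by positivity) (by norm_num)]
    have : (m : ℝ) ^ 2 ≤ k ^ 2 := by gcongr
    have : 0 ≤ (k : ℝ) ^ 2 := by positivity
    linarith
  have h2x : 2 * x ≤ (m : ℝ) ^ 2 * (1 / i - 1 / (k : ℝ)) := by
    have : (1 : ℝ) / i - 1 / k = 1 / (i * k) := by
      rw [div_sub_div _ _ (by positivity) (by positivity), hki]
      congr 1
      ring
    rw [this, hx, ← mul_div_assoc, mul_one_div, div_le_div_iff₀ (by positivity) (by positivity)]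
    have : (i : ℝ) * k ≤ k ^ 2 := by nlinarith
    have : (m : ℝ) ^ 2 * (i * k) ≤ m ^ 2 * k ^ 2 := by gcongr
    have : 0 ≤ (m : ℝ) ^ 2 * k ^ 2 := by positivity
    linarith
  calc Real.exp (-((m : ℝ) ^ 2 * (1 / i - 1 / (k : ℝ)))) ≤ Real.exp (-(2 * x)) :=
        Real.exp_le_exp.2 (by linarith)
    _ ≤ 1 - x := exp_neg_two_mul_le (by positivity) hx2
    _ ≤ 1 - Real.exp (-t) := by linarith

/-- The first `m` steps cost a factor `(m! / m ^ m) ^ 2 * 2 ^ (-m) ≥ exp (-3 * m)`, all later ones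
together only `exp (-m)`. -/
theorem prod_factor_ge {m : ℕ} (hm : m = ⌈Real.log n / 10⌉₊) :
    Real.exp (-(Real.log n / 2)) ≤
      ∏ i ∈ Finset.range (m ^ 2 - 1), (1 - (1 - attachProb p q (i + 1)) ^ blockSize n m i) := by
  obtain ⟨hm1, hm2, hm3⟩ := h.scale_bounds hm
  have hmpos : (1 : ℝ) ≤ m := by exact_mod_cast hm3
  have hm10 : 10 ≤ m := by
    have : (10 : ℝ) ≤ m := by linarith [h.log_ge]
    exact_mod_cast this
  have hbase : Real.exp (-(3 * m)) ≤
      ∏ i ∈ Finset.range m, (1 - (1 - attachProb p q (i + 1)) ^ blockSize n m i) := by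
    have hf : ∏ i ∈ Finset.range m, (((i + 1 : ℕ) : ℝ) ^ 2 / (2 * m ^ 2)) =
        (m.factorial / (m : ℝ) ^ m) ^ 2 * (1 / 2) ^ m := by
      rw [Finset.prod_div_distrib, Finset.prod_pow, ← Nat.cast_prod,
        Finset.prod_range_add_one_eq_factorial, Finset.prod_const, Finset.card_range, mul_pow,
        div_pow, div_pow, ← pow_mul, ← pow_mul, mul_comm 2 m, one_pow]
      field_simp
    refine le_trans ?_ (Finset.prod_le_prod (fun i _ => by positivity)
      fun i hi => h.factor_ge_of_lt hm (Finset.mem_range.1 hi))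
    rw [hf]
    have h1 : Real.exp (-m) ≤ m.factorial / (m : ℝ) ^ m := by
      have := Real.pow_div_factorial_le_exp (m : ℝ) (by positivity) m
      rw [Real.exp_neg, inv_le_comm₀ (Real.exp_pos _) (by positivity), inv_div]
      exact this
    have h2 : Real.exp (-1) ≤ 1 / 2 := by
      rw [Real.exp_neg, ← one_div]
      exact one_div_le_one_div_of_le (by norm_num) (by linarith [Real.exp_one_gt_d9])
    calc Real.exp (-(3 * m)) = Real.exp (-m) ^ 2 * Real.exp (-1) ^ m := by
          rw [← Real.exp_nat_mul, ← Real.exp_nat_mul, ← Real.exp_add]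
          congr 1; push_cast; ring
      _ ≤ _ := by gcongr
  have hstep : ∀ r, m ≤ r → r ≤ m ^ 2 - 1 →
      Real.exp (-(3 * m)) * Real.exp (-((m : ℝ) ^ 2 * (1 / m - 1 / r))) ≤
      ∏ i ∈ Finset.range r, (1 - (1 - attachProb p q (i + 1)) ^ blockSize n m i) := by
    intro r hr
    induction r, hr using Nat.le_induction with
    | base => intro _; simpa using hbase
    | succ r hr ih =>
      intro hr'
      rw [Finset.prod_range_succ]
      refine le_trans (le_of_eq ?_) (mul_le_mul (ih (by omega))
        (h.factor_ge_of_ge hm hr (by omega)) (Real.exp_pos _).le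
        (le_trans (by positivity) (ih (by omega))))
      rw [← Real.exp_add, ← Real.exp_add, ← Real.exp_add]
      congr 1
      ring
  refine le_trans ?_ (hstep (m ^ 2 - 1) (Nat.le_sub_one_of_lt (by nlinarith)) le_rfl)
  rw [← Real.exp_add]
  refine Real.exp_le_exp.2 ?_
  have h1 : (m : ℝ) ^ 2 * (1 / m - 1 / ((m ^ 2 - 1 : ℕ) : ℝ)) ≤ m := by
    have h2 : (0 : ℝ) ≤ 1 / ((m ^ 2 - 1 : ℕ) : ℝ) := by positivity
    calc _ ≤ (m : ℝ) ^ 2 * (1 / m) := by gcongr; linarith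
      _ = m := by field_simp
  linarith

theorem hasGrown_star_ge {m : ℕ} (hm : m = ⌈Real.log n / 10⌉₊) (x : Fin n) :
    Real.exp (-(Real.log n / 2)) ≤ (doubleGraph (intersectingPairs n) p q).real
      {H | HasGrown H.1 H.2 (star x) (m ^ 2)} := by
  obtain ⟨hm1, hm2, hm3⟩ := h.scale_bounds hm
  have hm0 : 1 ≤ m ^ 2 := Nat.one_le_pow _ _ hm3
  have hn100 : (100 : ℝ) ≤ n := by
    have := le_self_pow₀ (a := Real.log n) (by linarith [h.log_ge]) (by norm_num : 4 ≠ 0)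
    linarith [h.log_pow_le, h.log_ge]
  have := prod_le_hasGrown (F := intersectingPairs n) p q (blockSize n m) (m ^ 2 - 1)
    (star_adj x) (by
      rw [card_star]
      have h1 := sum_blockSize_le n hm3 (m ^ 2 - 1)
      have h2 : ((2 + ∑ i ∈ Finset.range (m ^ 2 - 1), blockSize n m i : ℕ) : ℝ) ≤ n := by
        push_cast; linarith
      have h3 : 2 + ∑ i ∈ Finset.range (m ^ 2 - 1), blockSize n m i ≤ n := by exact_mod_cast h2
      omega)
  rw [Nat.sub_add_cancel hm0] at this
  exact (h.prod_factor_ge hm).trans this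

theorem natCast_pow_eq (k : ℕ) : (n : ℝ) ^ k = Real.exp (k * Real.log n) := by
  rw [Real.exp_nat_mul, h.exp_log]

/-- The expected number of stuck sets of size `k` in a star. If `16 * k * log n ≤ n`, an attachment
probability of at least `4 * k * log n / n` at each of at least `n / 2` outside vertices beats the
`n ^ k` choices of the set. For larger `k`, an outside vertex fails to be attached with probability
at most `exp (-9984 * k * log n / n)`, which beats `n ^ min k j` choices, where `j` is the number of
outside vertices. -/
theorem stuck_term_le {k : ℕ} (hk : Real.log n ^ 2 ≤ 100 * k) (hkn : k < n - 1) :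
    ((n - 1).choose k : ℝ) * (1 - attachProb p q k) ^ (n - 1 - k) ≤
      Real.exp (-(3 * Real.log n)) := by
  have hn := h.pos
  have hℓ := h.log_ge
  have hlp := h.log_pow_le
  have hchoose : ∀ i : ℕ, ((n - 1).choose i : ℝ) ≤ Real.exp (i * Real.log n) := by
    intro i
    rw [← h.natCast_pow_eq]
    have : (n - 1).choose i ≤ n ^ i :=
      (Nat.choose_le_pow (n - 1) i).trans (Nat.pow_le_pow_left (Nat.sub_le n 1) i)
    exact_mod_cast this
  have h1q : 0 ≤ 1 - attachProb p q k := sub_nonneg.2 (attachProb_le_one p q k)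
  have hℓ4 := le_self_pow₀ (a := Real.log n) (by linarith) (by norm_num : 4 ≠ 0)
  set ℓ := Real.log n
  have hk100 : (100 : ℝ) ≤ k := by nlinarith
  obtain ⟨j, hj⟩ : ∃ j, n - 1 - k = j := ⟨_, rfl⟩
  have hj1 : 1 ≤ j := by omega
  have hj1' : (1 : ℝ) ≤ j := by exact_mod_cast hj1
  have hjk : (j : ℝ) + k + 1 = n := by exact_mod_cast (by omega : j + k + 1 = n)
  rw [hj]
  rcases le_total ((16 : ℝ) * k * ℓ) n with hcase | hcase
  · have hq : 4 * k * ℓ / n ≤ attachProb p q k := by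
      have hside : 4 * (4 * k * ℓ / n) ≤ k * (10000 * ℓ / n) := by
        rw [← mul_div_assoc, ← mul_div_assoc]
        gcongr ?_ / _
        nlinarith
      refine le_attachProb (by positivity) ?_ ?_ ?_ ?_
      · calc 4 * (4 * k * ℓ / n) ≤ k ^ 2 * (10000 / (n * ℓ)) := by
              rw [← mul_div_assoc, ← mul_div_assoc, div_le_div_iff₀ (by positivity) (by positivity)]
              have : 16 * ℓ ^ 2 * (k * n) ≤ 10000 * k * (k * n) := by
                refine mul_le_mul_of_nonneg_right ?_ (by positivity)
                linarith
              linarith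
          _ ≤ (k : ℝ) ^ 2 * ((p : ℝ) * q) := by gcongr; exact h.prod_ge
      · exact hside.trans (by gcongr; exact h.fst_ge)
      · exact hside.trans (by gcongr; exact h.snd_ge)
      · rw [← mul_div_assoc, div_le_one hn]
        linarith
    have hjn : (n : ℝ) / 2 ≤ j := by nlinarith
    calc ((n - 1).choose k : ℝ) * (1 - attachProb p q k) ^ j
        ≤ Real.exp (k * ℓ) * Real.exp (-(j * (4 * k * ℓ / n))) := by
          gcongr
          · exact hchoose k
          · refine (one_sub_pow_le_exp (attachProb_le_one p q k) j).trans (Real.exp_le_exp.2 ?_)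
            gcongr
      _ ≤ Real.exp (k * ℓ) * Real.exp (-((n : ℝ) / 2 * (4 * k * ℓ / n))) := by gcongr
      _ = Real.exp (-(k * ℓ)) := by
          rw [← Real.exp_add]; congr 1; field_simp; ring
      _ ≤ Real.exp (-(3 * ℓ)) := by gcongr; linarith
  · have hone : ∀ r : unitInterval, 10000 * ℓ / n ≤ (r : ℝ) →
        (1 - r : ℝ) ^ k ≤ Real.exp (-(10000 * k * ℓ / n)) := by
      intro r hr
      refine (one_sub_pow_le_exp r.2.2 k).trans (Real.exp_le_exp.2 (neg_le_neg ?_))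
      calc 10000 * k * ℓ / n = k * (10000 * ℓ / n) := by ring
        _ ≤ k * r := by gcongr
    have hq : 1 - attachProb p q k ≤ Real.exp (-(9984 * k * ℓ / n)) := by
      have h1 := hone p h.fst_ge
      have h2 := hone q h.snd_ge
      have h3 : 0 ≤ (1 - p : ℝ) ^ k * (1 - q : ℝ) ^ k := mul_nonneg
        (pow_nonneg (by linarith [p.2.2]) _) (pow_nonneg (by linarith [q.2.2]) _)
      -- the factor `2` from the two colours is absorbed by a small part of the exponent
      have h4 : 2 ≤ Real.exp (16 * k * ℓ / n) := by
        have : 1 ≤ 16 * k * ℓ / n := by rwa [one_le_div hn]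
        linarith [Real.add_one_le_exp (16 * k * ℓ / n)]
      have h5 : Real.exp (-(9984 * k * ℓ / n)) =
          Real.exp (16 * k * ℓ / n) * Real.exp (-(10000 * k * ℓ / n)) := by
        rw [← Real.exp_add]; congr 1; ring
      rw [h5, attachProb]
      nlinarith [Real.exp_pos (-(10000 * k * ℓ / n))]
    have hpow : (1 - attachProb p q k) ^ j ≤ Real.exp (-(9984 * (k * j / n) * ℓ)) := by
      calc (1 - attachProb p q k) ^ j ≤ Real.exp (-(9984 * k * ℓ / n)) ^ j := by gcongr
        _ = _ := by rw [← Real.exp_nat_mul]; congr 1; ring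
    have hfin : ∀ i : ℕ, 1 ≤ i → ((n - 1).choose k : ℝ) ≤ Real.exp (i * ℓ) →
        (i : ℝ) / 4 ≤ k * j / n → ((n - 1).choose k : ℝ) * (1 - attachProb p q k) ^ j ≤
          Real.exp (-(3 * ℓ)) := by
      intro i hi hc hle
      have hi' : (1 : ℝ) ≤ i := by exact_mod_cast hi
      refine (mul_le_mul hc hpow (pow_nonneg h1q _) (Real.exp_pos _).le).trans ?_
      rw [← Real.exp_add]
      refine Real.exp_le_exp.2 ?_
      have e1 : (i : ℝ) / 4 * ℓ ≤ k * j / n * ℓ := by gcongr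
      have e2 : 1 * ℓ ≤ i * ℓ := by gcongr
      nlinarith
    have hn2 : (2 : ℝ) ≤ n := by linarith
    rcases le_total k j with hle | hle
    · refine hfin k (by exact_mod_cast (by linarith : (1 : ℝ) ≤ k)) (hchoose k) ?_
      have : (k : ℝ) ≤ j := by exact_mod_cast hle
      rw [div_le_div_iff₀ (by norm_num) hn]
      nlinarith
    · refine hfin j hj1 ?_ ?_
      · rw [← Nat.choose_symm (by omega : k ≤ n - 1), hj]
        exact hchoose j
      · have : (j : ℝ) ≤ k := by exact_mod_cast hle
        rw [div_le_div_iff₀ (by norm_num) hn]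
        nlinarith

theorem not_percolates_prob_le :
    (doubleGraph (intersectingPairs n) p q).real {H | ¬ JigsawPercolates H.1 H.2} ≤ 2 / n := by
  obtain ⟨m, hm⟩ : ∃ m, m = ⌈Real.log n / 10⌉₊ := ⟨_, rfl⟩
  obtain ⟨hm1, hm2, hm3⟩ := h.scale_bounds hm
  have hn := h.pos
  have hℓ := h.log_ge
  have hlp := h.log_pow_le
  have hm2n : ((m ^ 2 : ℕ) : ℝ) ≤ Real.log n ^ 2 := by push_cast; gcongr; linarith
  have hℓ24 : Real.log n ^ 2 ≤ Real.log n ^ 4 := pow_le_pow_right₀ (by linarith) (by norm_num)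
  have hk₀ : m ^ 2 ≤ n := by
    have : ((m ^ 2 : ℕ) : ℝ) ≤ n := by nlinarith
    exact_mod_cast this
  refine (LineJigsaw.not_percolates_prob_le p q hk₀ (h.hasGrown_star_ge hm)).trans ?_
  have hsum : n * ∑ k ∈ Finset.Ico (m ^ 2) (n - 1),
      ((n - 1).choose k : ℝ) * (1 - attachProb p q k) ^ (n - 1 - k) ≤ 1 / n := by
    have h1 : ∑ k ∈ Finset.Ico (m ^ 2) (n - 1),
        ((n - 1).choose k : ℝ) * (1 - attachProb p q k) ^ (n - 1 - k) ≤
        n * Real.exp (-(3 * Real.log n)) := by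
      refine (Finset.sum_le_card_nsmul _ _ (Real.exp (-(3 * Real.log n))) fun k hk => ?_).trans ?_
      · rw [Finset.mem_Ico] at hk
        refine h.stuck_term_le ?_ hk.2
        have : (m : ℝ) ^ 2 ≤ k := by exact_mod_cast hk.1
        nlinarith
      · rw [nsmul_eq_mul, Nat.card_Ico]
        refine mul_le_mul_of_nonneg_right ?_ (Real.exp_pos _).le
        exact Nat.cast_le.2 ((Nat.sub_le _ _).trans (Nat.sub_le _ _))
    calc _ ≤ n * (n * Real.exp (-(3 * Real.log n))) := by gcongr
      _ = 1 / n := by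
          rw [Real.exp_neg, show (3 : ℝ) * Real.log n = (3 : ℕ) * Real.log n by norm_num,
            ← h.natCast_pow_eq]
          field_simp
  have hsecond : (n.choose (m ^ 2) : ℝ) * (1 - Real.exp (-(Real.log n / 2))) ^ (n - m ^ 2) ≤
      1 / n := by
    have hhalf : Real.exp (-(Real.log n / 2)) = 1 / √n := by
      rw [Real.exp_neg, ← one_div, Real.exp_half, h.exp_log]
    have hs2 := Real.sq_sqrt (Nat.cast_nonneg (α := ℝ) n)
    have hs1 := h.one_le_sqrt
    have hle1 : Real.exp (-(Real.log n / 2)) ≤ 1 := Real.exp_le_one_iff.2 (by linarith)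
    have hchoose : (n.choose (m ^ 2) : ℝ) ≤ Real.exp (((m ^ 2 : ℕ) : ℝ) * Real.log n) := by
      rw [← h.natCast_pow_eq]
      exact_mod_cast Nat.choose_le_pow n (m ^ 2)
    refine (mul_le_mul hchoose (one_sub_pow_le_exp hle1 _)
      (pow_nonneg (by linarith) _) (Real.exp_pos _).le).trans ?_
    have hinv : 1 / (n : ℝ) = Real.exp (-Real.log n) := by rw [Real.exp_neg, h.exp_log, one_div]
    rw [← Real.exp_add, hinv]
    refine Real.exp_le_exp.2 ?_
    rw [hhalf]
    have hsub : (n : ℝ) / 2 ≤ ((n - m ^ 2 : ℕ) : ℝ) := by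
      rw [Nat.cast_sub hk₀]
      nlinarith
    have h1 : √(n : ℝ) / 2 ≤ ((n - m ^ 2 : ℕ) : ℝ) * (1 / √n) := by
      rw [mul_one_div, le_div_iff₀ (by linarith)]
      nlinarith
    have h2 : ((m ^ 2 : ℕ) : ℝ) * Real.log n ≤ Real.log n ^ 2 * Real.log n := by gcongr
    have h3 : Real.log n ^ 2 * Real.log n ≤ Real.log n ^ 4 := by
      rw [← pow_succ]; exact pow_le_pow_right₀ (by linarith) (by norm_num)
    have h4 := le_self_pow₀ (a := Real.log n) (by linarith) (by norm_num : 4 ≠ 0)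
    have h5 := h.log_le
    linarith
  calc _ ≤ 1 / (n : ℝ) + 1 / n := add_le_add hsum hsecond
    _ = 2 / n := by ring

end Supercritical

theorem eventually_log_pow_le :
    ∀ᶠ n : ℕ in atTop, 100 ≤ Real.log n ∧ 10000 * Real.log n ^ 4 ≤ √(n : ℝ) := by
  have h1 : ∀ᶠ n : ℕ in atTop, 100 ≤ Real.log n :=
    (Real.tendsto_log_atTop.comp tendsto_natCast_atTop_atTop).eventually_ge_atTop 100
  have h2 : ∀ᶠ x : ℝ in atTop, 10000 * Real.log x ^ 4 ≤ √x := by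
    have := (isLittleO_log_rpow_rpow_atTop 4 (by norm_num : (0 : ℝ) < 1 / 2)).bound
      (by norm_num : (0 : ℝ) < 1 / 10000)
    filter_upwards [this, eventually_ge_atTop 1] with x hx hx1
    have hlog : 0 ≤ Real.log x := Real.log_nonneg hx1
    rw [Real.norm_of_nonneg (by positivity), Real.norm_of_nonneg (by positivity),
      ← Real.sqrt_eq_rpow, show (4 : ℝ) = (4 : ℕ) by norm_num, Real.rpow_natCast] at hx
    linarith
  filter_upwards [h1, tendsto_natCast_atTop_atTop.eventually h2] with n h1 h2
  exact ⟨h1, h2⟩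

end

/-! ### The threshold -/

theorem tendsto_measure_one_of_real_compl {Ω : ℕ → Type*} [∀ n, MeasurableSpace (Ω n)]
    [∀ n, DiscreteMeasurableSpace (Ω n)] {μ : ∀ n, Measure (Ω n)} [∀ n, IsProbabilityMeasure (μ n)]
    {E : ∀ n, Set (Ω n)} {ε : ℕ → ℝ} (hε : Tendsto ε atTop (𝓝 0))
    (h : ∀ᶠ n in atTop, (μ n).real (E n)ᶜ ≤ ε n) :
    Tendsto (fun n => μ n (E n)) atTop (𝓝 1) := by
  have h0 : Tendsto (fun n => (μ n).real (E n)ᶜ) atTop (𝓝 0) :=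
    squeeze_zero' (Eventually.of_forall fun _ => measureReal_nonneg) h hε
  have h1 : Tendsto (fun n => (μ n).real (E n)) atTop (𝓝 1) := by
    have h2 : ∀ n, (μ n).real (E n) = 1 - (μ n).real (E n)ᶜ := by
      intro n
      rw [probReal_compl_eq_one_sub .of_discrete]; ring
    simp only [h2]
    simpa using h0.const_sub 1
  have h3 := (ENNReal.continuous_ofReal.tendsto 1).comp h1
  rw [ENNReal.ofReal_one] at h3
  refine h3.congr fun n => ?_
  exact ofReal_measureReal (measure_ne_top _ _)

end LineJigsaw

open LineJigsaw in
theorem theorem4p1 :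
    ∃ c : ℝ, 0 < c ∧ ∀ p₁ p₂ : ℕ → unitInterval,
      ((∀ᶠ n : ℕ in atTop, (p₁ n : ℝ) * (p₂ n : ℝ) ≤ 1 / (c * (n : ℝ) * Real.log n)) →
        Tendsto (fun n : ℕ => lineDoubleGraph n (p₁ n) (p₂ n) {H | ¬ JigsawPercolates H.1 H.2})
          atTop (𝓝 1)) ∧
      ((∀ᶠ n : ℕ in atTop, c / ((n : ℝ) * Real.log n) ≤ (p₁ n : ℝ) * (p₂ n : ℝ) ∧
          c * Real.log n / (n : ℝ) ≤ min (p₁ n : ℝ) (p₂ n : ℝ)) →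
        Tendsto (fun n : ℕ => lineDoubleGraph n (p₁ n) (p₂ n) {H | JigsawPercolates H.1 H.2})
          atTop (𝓝 1)) := by
  refine ⟨10000, by norm_num, fun p₁ p₂ => ⟨fun hp => ?_, fun hp => ?_⟩⟩
  · refine tendsto_measure_one_of_real_compl
      (μ := fun n => doubleGraph (intersectingPairs n) (p₁ n) (p₂ n)) tendsto_log_sq_div_sq ?_
    filter_upwards [hp, eventually_log_pow_le, eventually_ge_atTop 3] with n h1 h2 h3
    have := percolates_prob_le_of_subcritical (by linarith [h2.1]) h3 h1
    rwa [Set.compl_ofPred, show {H : SimpleGraph (TwoSets n) × SimpleGraph (TwoSets n) |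
      ¬ ¬ JigsawPercolates H.1 H.2} = {H | JigsawPercolates H.1 H.2} by simp only [not_not]]
  · refine tendsto_measure_one_of_real_compl
      (μ := fun n => doubleGraph (intersectingPairs n) (p₁ n) (p₂ n))
      (tendsto_const_div_atTop_nhds_zero_nat 2) ?_
    filter_upwards [hp, eventually_log_pow_le] with n h1 h2
    exact Supercritical.not_percolates_prob_le ⟨h2.1, h2.2, h1.1,
      h1.2.trans (min_le_left _ _), h1.2.trans (min_le_right _ _)⟩
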